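/- Two sets $\{p_1,\dots,p_n\}$ and $\{q_1,\dots,q_n\}$ of $n$ labeled points in general position in the plane (distinct points, no three collinear) have the same order type if for every triple $(i,j,k)$ of distinct indices, $p_k$ lies above (to the left of) the directed line from $p_i$ to $p_j$ if and only if $q_k$ lies above the directed line from $q_i$ to $q_j$. Let $g(n,\alpha)$ be the number of different order types of $n$ labeled points in general position that can be realized by points whose coordinates are nonnegative integers smaller than $n^{\alpha}$. If $\alpha \ge 2.5$, then \[ g(n,\alpha) \ge \exp\bigl(3n\log n - O(n\log\log n)\bigr), \] that is, there are constants $C>0$ and $n_0$, independent of $\alpha$, such that $g(n,\alpha)\ge \exp(3n\log n - C\,n\log\log n)$ for all $\alpha\ge 2.5$ and all integers $n\ge n_0$. -/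

import Mathlib

/-- The point `r` lies strictly above (i.e. strictly to the left of) the line through `p` and `q`
directed from `p` to `q`: the triple `p, q, r` is counterclockwise. -/
def AboveLine (p q r : ℝ × ℝ) : Prop :=
  0 < (q.1 - p.1) * (r.2 - p.2) - (q.2 - p.2) * (r.1 - p.1)

/-- A labeled family of points in the plane is in general position: the points are distinct and
no three of them are collinear. -/
def InGeneralPosition {n : ℕ} (p : Fin n → ℝ × ℝ) : Prop :=
  Function.Injective p ∧
    ∀ i j k : Fin n, i ≠ j → i ≠ k → j ≠ k → ¬ Collinear ℝ {p i, p j, p k}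

/-- Sets of `n` labeled points in general position in the plane. -/
abbrev PointConfig (n : ℕ) : Type := {p : Fin n → ℝ × ℝ // InGeneralPosition p}

/-- Two labeled point sets have the same order type if they have the same above-below
relationships. The labels are respected: no relabeling is allowed. -/
def SameOrderType {n : ℕ} (S T : PointConfig n) : Prop :=
  ∀ i j k : Fin n, i ≠ j → i ≠ k → j ≠ k →
    (AboveLine (S.1 i) (S.1 j) (S.1 k) ↔ AboveLine (T.1 i) (T.1 j) (T.1 k))

/-- Having the same order type is an equivalence relation. -/
instance orderTypeSetoid (n : ℕ) : Setoid (PointConfig n) where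
  r := SameOrderType
  iseqv :=
    { refl := fun _ _ _ _ _ _ _ => Iff.rfl
      symm := fun h i j k hij hik hjk => (h i j k hij hik hjk).symm
      trans := fun h h' i j k hij hik hjk => (h i j k hij hik hjk).trans (h' i j k hij hik hjk) }

/-- The (realizable, labeled) order types of `n` points in general position. -/
def PlanarOrderType (n : ℕ) : Type := Quotient (orderTypeSetoid n)

/-- There are finitely many order types of `n` points, so that counting them by `Set.ncard`
is meaningful. -/
instance orderTypeFinite (n : ℕ) : Finite (PlanarOrderType n) := by
  let f : PlanarOrderType n → (Fin n → Fin n → Fin n → Prop) := fun t =>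
    Quotient.lift (s := orderTypeSetoid n)
      (fun S i j k => i ≠ j ∧ i ≠ k ∧ j ≠ k ∧ AboveLine (S.1 i) (S.1 j) (S.1 k))
      (by
        intro S T h
        funext i j k
        apply propext
        constructor
        · rintro ⟨a, b, c, d⟩
          exact ⟨a, b, c, (h i j k a b c).1 d⟩
        · rintro ⟨a, b, c, d⟩
          exact ⟨a, b, c, (h i j k a b c).2 d⟩) t
  apply Finite.of_injective f
  intro s t
  refine Quotient.inductionOn₂ s t ?_
  intro S T h
  apply Quotient.sound
  intro i j k a b c
  have h' := congrFun (congrFun (congrFun h i) j) k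
  constructor
  · intro d
    exact (h'.mp ⟨a, b, c, d⟩).2.2.2
  · intro d
    exact (h'.mpr ⟨a, b, c, d⟩).2.2.2

/-- The points of `S` belong to the integer grid of side `s`: their coordinates are nonnegative
integers smaller than `s`. -/
def InGrid {n : ℕ} (s : ℝ) (S : PointConfig n) : Prop :=
  ∀ i : Fin n, ∃ a b : ℕ, (a : ℝ) < s ∧ (b : ℝ) < s ∧ S.1 i = ((a : ℝ), (b : ℝ))

/-- `gridOrderTypes n α` is the number `g(n, α)` of different order types of `n` points that are
realizable with nonnegative integer coordinates smaller than `n ^ α`. -/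
noncomputable def gridOrderTypes (n : ℕ) (α : ℝ) : ℕ :=
  Set.ncard {t : PlanarOrderType n |
    ∃ S : PointConfig n, InGrid ((n : ℝ) ^ α) S ∧ Quotient.mk (orderTypeSetoid n) S = t}

/-!
Let `L` be about `log n`. Put `k ≈ n / L` points on each of two flat parabolic arcs, one at the
bottom and one at the top of the grid, so that `k ^ 2` lines join them. The displacements of
any two of these lines at the bottom and at the top are governed by the gaps of the arcs; hence two
lines come close to each other only on a short range of rows, and on an average row only about
`k ^ 2 * L` pairs of crossings are close. By the Cauchy–Schwarz inequality such a row contains about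
`k ^ 2 / L` pairwise separated crossings, and a new point on this row has as many positions which
these lines tell apart.

Almost horizontal lines through `k` further pairs of points cut the lower part of the grid into `k`
strips, which they also tell apart, and a positive proportion of the strips contain a good row that
is not occupied yet. Discarding the few columns that would create a collinear triple, there remain
`n ^ 3 / L ^ O(1)` choices for each of the `n - 4 * k` points still to be placed, and different
choices give different order types. A grid of side `n ^ 2 * L ^ O(1)` is enough for this, hence any
exponent above `2` will do.
-/

open Finset Function

/-- Twice the signed area of the triangle `p q r`, positive when `r` lies to the left of the line
from `p` to `q`. All points constructed below are integral, so that orientations are computed in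
`ℤ`. -/
def orient (p q r : ℤ × ℤ) : ℤ :=
  (q.1 - p.1) * (r.2 - p.2) - (q.2 - p.2) * (r.1 - p.1)

theorem orient_swap_left (p q r : ℤ × ℤ) : orient q p r = -orient p q r := by
  unfold orient; ring

theorem orient_rotate (p q r : ℤ × ℤ) : orient q r p = orient p q r := by
  unfold orient; ring

theorem orient_swap_right (p q r : ℤ × ℤ) : orient p r q = -orient p q r := by
  unfold orient; ring

/-- The point of the real plane with the given integer coordinates. -/
def toPlane (p : ℤ × ℤ) : ℝ × ℝ := (p.1, p.2)

theorem aboveLine_toPlane_iff (p q r : ℤ × ℤ) :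
    AboveLine (toPlane p) (toPlane q) (toPlane r) ↔ 0 < orient p q r := by
  simp only [AboveLine, toPlane, orient]
  norm_cast

theorem orient_eq_zero_of_collinear {p q r : ℤ × ℤ}
    (h : Collinear ℝ {toPlane p, toPlane q, toPlane r}) : orient p q r = 0 := by
  obtain ⟨v, hv⟩ := (collinear_iff_of_mem (p₀ := toPlane p) (by simp)).1 h
  obtain ⟨a, ha⟩ := hv (toPlane q) (by simp)
  obtain ⟨b, hb⟩ := hv (toPlane r) (by simp)
  simp only [toPlane, vadd_eq_add, Prod.ext_iff, Prod.fst_add, Prod.snd_add, Prod.smul_fst,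
    Prod.smul_snd, smul_eq_mul] at ha hb
  have hzero : (orient p q r : ℝ) = 0 := by
    unfold orient
    push_cast
    rw [ha.1, ha.2, hb.1, hb.2]
    ring
  exact_mod_cast hzero

/-- The abscissa at which the line through `p` and `q` meets the horizontal line of height `y`.
It is meaningful when `p` and `q` have different heights. -/
noncomputable def rowCrossing (p q : ℤ × ℤ) (y : ℝ) : ℝ :=
  p.1 + (q.1 - p.1) / (q.2 - p.2) * (y - p.2)

theorem orient_eq_mul_rowCrossing_sub {p q : ℤ × ℤ} (h : p.2 ≠ q.2) (x y : ℤ) :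
    (orient p q (x, y) : ℝ) = (q.2 - p.2) * (rowCrossing p q y - x) := by
  have hne : (q.2 - p.2 : ℝ) ≠ 0 := sub_ne_zero.2 (by exact_mod_cast h.symm)
  unfold rowCrossing orient
  push_cast
  field_simp
  ring

theorem orient_pos_iff_lt_rowCrossing {p q : ℤ × ℤ} (h : p.2 < q.2) (x y : ℤ) :
    0 < orient p q (x, y) ↔ (x : ℝ) < rowCrossing p q y := by
  have hpos : (0 : ℝ) < q.2 - p.2 := sub_pos.2 (by exact_mod_cast h)
  rw [← Int.cast_pos (R := ℝ), orient_eq_mul_rowCrossing_sub h.ne, mul_pos_iff_of_pos_left hpos,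
    sub_pos]

theorem rowCrossing_mem_Icc {p q : ℤ × ℤ} {y a b : ℝ} (hpq : p.2 < q.2)
    (hy : y ∈ Set.Icc (p.2 : ℝ) q.2) (hp : (p.1 : ℝ) ∈ Set.Icc a b)
    (hq : (q.1 : ℝ) ∈ Set.Icc a b) : rowCrossing p q y ∈ Set.Icc a b := by
  have hpos : (0 : ℝ) < q.2 - p.2 := sub_pos.2 (by exact_mod_cast hpq)
  have hcomb : rowCrossing p q y = AffineMap.lineMap (p.1 : ℝ) q.1 ((y - p.2) / (q.2 - p.2)) := by
    rw [AffineMap.lineMap_apply_ring']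
    unfold rowCrossing
    ring
  rw [hcomb]
  refine (convex_Icc a b).lineMap_mem hp hq ⟨div_nonneg (sub_nonneg.2 hy.1) hpos.le, ?_⟩
  exact (div_le_one hpos).2 (sub_le_sub_right hy.2 _)

/-- The first `m` points of `P` lie in the integer grid of side `N`, on pairwise different
horizontal lines, and no three of them are collinear. Values of `P` from `m` on are irrelevant; this
lets configurations grow by `Function.update`. -/
structure IsGridConfig (N m : ℕ) (P : ℕ → ℤ × ℤ) : Prop where
  fst_mem : ∀ i < m, (P i).1 ∈ Set.Ico (0 : ℤ) N
  snd_mem : ∀ i < m, (P i).2 ∈ Set.Ico (0 : ℤ) N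
  snd_injOn : Set.InjOn (fun i => (P i).2) (Set.Iio m)
  orient_ne : ∀ i j l, i < j → j < l → l < m → orient (P i) (P j) (P l) ≠ 0

/-- The orientation pattern of the first `m` points of `P`: the increasing triples of indices whose
points are in counterclockwise order. -/
def chirotope (m : ℕ) (P : ℕ → ℤ × ℤ) : Set (ℕ × ℕ × ℕ) :=
  {t | t.1 < t.2.1 ∧ t.2.1 < t.2.2 ∧ t.2.2 < m ∧ 0 < orient (P t.1) (P t.2.1) (P t.2.2)}

namespace IsGridConfig

variable {N n m : ℕ} {P P' : ℕ → ℤ × ℤ}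

theorem orient_ne_zero (h : IsGridConfig N m P) {i j l : ℕ} (hi : i < m) (hj : j < m) (hl : l < m)
    (hij : i ≠ j) (hil : i ≠ l) (hjl : j ≠ l) : orient (P i) (P j) (P l) ≠ 0 := by
  have hsorted := h.orient_ne
  grind [orient_swap_left, orient_swap_right]

theorem inGeneralPosition (h : IsGridConfig N n P) :
    InGeneralPosition (fun i : Fin n => toPlane (P i)) := by
  refine ⟨fun i j hij => ?_, fun i j l hij hil hjl hcol => ?_⟩
  · have hrow : (P i).2 = (P j).2 := by
      simpa [toPlane] using congrArg Prod.snd hij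
    exact Fin.ext (h.snd_injOn i.2 j.2 hrow)
  · exact h.orient_ne_zero i.2 j.2 l.2 (Fin.val_ne_of_ne hij) (Fin.val_ne_of_ne hil)
      (Fin.val_ne_of_ne hjl) (orient_eq_zero_of_collinear hcol)

/-- The labeled point set of the real plane given by a grid configuration. -/
def toPointConfig (h : IsGridConfig N n P) : PointConfig n :=
  ⟨fun i => toPlane (P i), h.inGeneralPosition⟩

theorem inGrid_toPointConfig (h : IsGridConfig N n P) {s : ℝ} (hN : N ≤ s) :
    InGrid s h.toPointConfig := by
  intro i
  obtain ⟨a, ha⟩ := Int.eq_ofNat_of_zero_le (h.fst_mem i i.2).1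
  obtain ⟨b, hb⟩ := Int.eq_ofNat_of_zero_le (h.snd_mem i i.2).1
  have haN : a < N := by exact_mod_cast ha ▸ (h.fst_mem i i.2).2
  have hbN : b < N := by exact_mod_cast hb ▸ (h.snd_mem i i.2).2
  refine ⟨a, b, hN.trans_lt' (by exact_mod_cast haN), hN.trans_lt' (by exact_mod_cast hbN), ?_⟩
  simp [toPointConfig, toPlane, ha, hb]

theorem chirotope_eq_of_sameOrderType (h : IsGridConfig N n P) (h' : IsGridConfig N n P')
    (hS : SameOrderType h.toPointConfig h'.toPointConfig) : chirotope n P = chirotope n P' := by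
  ext ⟨i, j, l⟩
  simp only [chirotope, Set.mem_ofPred_eq, and_congr_right_iff]
  intro hij hjl hl
  rw [← aboveLine_toPlane_iff, ← aboveLine_toPlane_iff]
  exact hS ⟨i, by omega⟩ ⟨j, by omega⟩ ⟨l, hl⟩ (by simp; omega) (by simp; omega) (by simp; omega)

end IsGridConfig

theorem card_le_gridOrderTypes {N n : ℕ} {α : ℝ} {F : Finset (ℕ → ℤ × ℤ)}
    (hF : ∀ P ∈ F, IsGridConfig N n P) (hinj : Set.InjOn (chirotope n) F)
    (hN : (N : ℝ) ≤ (n : ℝ) ^ α) : #F ≤ gridOrderTypes n α := by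
  let orderType : F → PlanarOrderType n := fun P => Quotient.mk _ (hF P P.2).toPointConfig
  have horderType : Injective orderType := fun P P' h =>
    Subtype.ext (hinj P.2 P'.2
      ((hF P P.2).chirotope_eq_of_sameOrderType (hF P' P'.2) (Quotient.exact h)))
  calc #F = (Set.range orderType).ncard := by
        rw [Set.ncard_range_of_injective horderType, Nat.card_eq_fintype_card, Fintype.card_coe]
    _ ≤ gridOrderTypes n α := by
        refine Set.ncard_le_ncard ?_ (Set.toFinite _)
        rintro _ ⟨P, rfl⟩
        exact ⟨_, (hF P P.2).inGrid_toPointConfig hN, rfl⟩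

section Extension

variable {m : ℕ} {P P' : ℕ → ℤ × ℤ} {p p' : ℤ × ℤ}

theorem mem_chirotope_iff_mem_chirotope_update {t : ℕ × ℕ × ℕ} :
    t ∈ chirotope m P ↔ t ∈ chirotope (m + 1) (update P m p) ∧ t.2.2 < m := by
  simp only [chirotope, Set.mem_ofPred_eq]
  constructor
  · rintro ⟨hij, hjl, hl, h⟩
    rw [update_of_ne (by omega), update_of_ne (by omega), update_of_ne (by omega)]
    exact ⟨⟨hij, hjl, by omega, h⟩, hl⟩
  · rintro ⟨⟨hij, hjl, -, h⟩, hl⟩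
    rw [update_of_ne (by omega), update_of_ne (by omega), update_of_ne (by omega)] at h
    exact ⟨hij, hjl, hl, h⟩

theorem chirotope_eq_of_chirotope_update_eq
    (h : chirotope (m + 1) (update P m p) = chirotope (m + 1) (update P' m p')) :
    chirotope m P = chirotope m P' := by
  ext t
  rw [mem_chirotope_iff_mem_chirotope_update (p := p), h, ← mem_chirotope_iff_mem_chirotope_update]

theorem chirotope_update_ne {i j : ℕ} (hij : i < j) (hjm : j < m)
    (hp : 0 < orient (P i) (P j) p) (hp' : ¬ 0 < orient (P i) (P j) p') :
    chirotope (m + 1) (update P m p) ≠ chirotope (m + 1) (update P m p') := by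
  have hmem : ∀ r, (i, j, m) ∈ chirotope (m + 1) (update P m r) ↔ 0 < orient (P i) (P j) r := by
    intro r
    simp only [chirotope, Set.mem_ofPred_eq, update_self, update_of_ne (by omega : i ≠ m),
      update_of_ne (by omega : j ≠ m)]
    exact ⟨fun h => h.2.2.2, fun h => ⟨hij, hjm, by omega, h⟩⟩
  exact fun h => hp' ((hmem p').1 (h ▸ (hmem p).2 hp))

theorem exists_finset_injOn_chirotope {V : ℕ → (ℕ → ℤ × ℤ) → Prop} {m₀ Q : ℕ}
    {P₀ : ℕ → ℤ × ℤ} (h₀ : V m₀ P₀) (e : ℕ)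
    (hstep : ∀ m P, m₀ ≤ m → m < m₀ + e → V m P → ∃ C : Finset (ℤ × ℤ), Q ≤ #C ∧
      (∀ p ∈ C, V (m + 1) (update P m p)) ∧
      Set.InjOn (fun p => chirotope (m + 1) (update P m p)) C) :
    ∃ F : Finset (ℕ → ℤ × ℤ), Q ^ e ≤ #F ∧ (∀ P ∈ F, V (m₀ + e) P) ∧
      Set.InjOn (chirotope (m₀ + e)) F := by
  classical
  induction e with
  | zero => exact ⟨{P₀}, by simp, by simpa using h₀, by simp⟩
  | succ e ih =>
    obtain ⟨F, hcard, hV, hinj⟩ := ih fun m P hm₀ hm => hstep m P hm₀ (by omega)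
    have hext := fun P => hstep (m₀ + e) P (by omega) (by omega)
    choose! C hCcard hCV hCinj using hext
    let extend : (_ : ℕ → ℤ × ℤ) × (ℤ × ℤ) → ℕ → ℤ × ℤ := fun c => update c.1 (m₀ + e) c.2
    have hextend : Set.InjOn (chirotope (m₀ + e + 1) ∘ extend) (F.sigma C) := by
      rintro ⟨P, p⟩ hp ⟨P', p'⟩ hp' h
      obtain ⟨hP, hp⟩ := mem_sigma.1 (mem_coe.1 hp)
      obtain ⟨hP', hp'⟩ := mem_sigma.1 (mem_coe.1 hp')
      obtain rfl : P = P' := hinj hP hP' (chirotope_eq_of_chirotope_update_eq h)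
      obtain rfl : p = p' := hCinj P (hV P hP) hp hp' h
      rfl
    refine ⟨(F.sigma C).image extend, ?_, ?_, ?_⟩
    · calc Q ^ (e + 1) = Q ^ e * Q := pow_succ Q e
        _ ≤ #F * Q := Nat.mul_le_mul_right Q hcard
        _ ≤ ∑ P ∈ F, #(C P) := card_nsmul_le_sum F _ Q fun P hP => hCcard P (hV P hP)
        _ = #((F.sigma C).image extend) := by
            rw [← card_sigma, card_image_of_injOn (Set.InjOn.of_comp hextend)]
    · intro P hP
      obtain ⟨c, hc, rfl⟩ := mem_image.1 hP
      exact hCV c.1 (hV _ (mem_sigma.1 hc).1) _ (mem_sigma.1 hc).2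
    · rw [coe_image]
      exact hextend.image_of_comp

end Extension

namespace IsGridConfig

variable {N m : ℕ} {P : ℕ → ℤ × ℤ}

theorem update_of_orient_ne (h : IsGridConfig N m P) {x y : ℤ} (hx : x ∈ Set.Ico (0 : ℤ) N)
    (hy : y ∈ Set.Ico (0 : ℤ) N) (hrow : ∀ i < m, (P i).2 ≠ y)
    (horient : ∀ i j, i < j → j < m → orient (P i) (P j) (x, y) ≠ 0) :
    IsGridConfig N (m + 1) (update P m (x, y)) := by
  have hold : ∀ i < m, update P m (x, y) i = P i := fun i hi => update_of_ne hi.ne _ _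
  have hnew : update P m (x, y) m = (x, y) := update_self _ _ _
  refine ⟨fun i hi => ?_, fun i hi => ?_, ?_, fun i j l hij hjl hl => ?_⟩
  · rcases Nat.lt_succ_iff_lt_or_eq.1 hi with hi | rfl
    · simpa only [hold i hi] using h.fst_mem i hi
    · simpa only [hnew] using hx
  · rcases Nat.lt_succ_iff_lt_or_eq.1 hi with hi | rfl
    · simpa only [hold i hi] using h.snd_mem i hi
    · simpa only [hnew] using hy
  · intro i hi j hj hij
    rcases Nat.lt_succ_iff_lt_or_eq.1 hi with hi | rfl <;>
      rcases Nat.lt_succ_iff_lt_or_eq.1 hj with hj | rfl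
    · exact h.snd_injOn hi hj (by simpa only [hold i hi, hold j hj] using hij)
    · exact absurd (by simpa only [hold i hi, hnew] using hij) (hrow i hi)
    · exact absurd (by simpa only [hold j hj, hnew] using hij.symm) (hrow j hj)
    · rfl
  · rcases Nat.lt_succ_iff_lt_or_eq.1 hl with hl | rfl
    · rw [hold i (by omega), hold j (by omega), hold l hl]
      exact h.orient_ne i j l hij hjl hl
    · rw [hold i (by omega), hold j hjl, hnew]
      exact horient i j hij hjl

/-- A column is forbidden if it is where the row meets a line through two earlier points. -/
theorem exists_forbidden_columns (h : IsGridConfig N m P) {y : ℤ} (hy : y ∈ Set.Ico (0 : ℤ) N)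
    (hrow : ∀ i < m, (P i).2 ≠ y) :
    ∃ K : Finset ℤ, #K ≤ m ^ 2 ∧ ∀ x ∈ Set.Ico (0 : ℤ) N, x ∉ K →
      IsGridConfig N (m + 1) (update P m (x, y)) := by
  classical
  refine ⟨(range m ×ˢ range m).image fun e => ⌊rowCrossing (P e.1) (P e.2) y⌋, ?_,
    fun x hx hxK => h.update_of_orient_ne hx hy hrow fun i j hij hj h0 => hxK ?_⟩
  · exact card_image_le.trans (by rw [card_product, card_range, sq])
  · have hne : (P i).2 ≠ (P j).2 := fun e => hij.ne (h.snd_injOn (hij.trans hj) hj e)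
    have hcross : rowCrossing (P i) (P j) y = x := by
      have hmul := orient_eq_mul_rowCrossing_sub hne x y
      rw [h0, Int.cast_zero, zero_eq_mul, sub_eq_zero, sub_eq_zero] at hmul
      exact hmul.resolve_left (by exact_mod_cast hne.symm)
    refine mem_image.2 ⟨(i, j), by simp; omega, ?_⟩
    rw [hcross, Int.floor_intCast]

theorem exists_append (h : IsGridConfig N m P) (ρ : ℕ → ℤ) (C : ℕ → Finset ℤ) (t : ℕ)
    (hρ : ∀ s < t, ρ s ∈ Set.Ico (0 : ℤ) N) (hρP : ∀ i < m, ∀ s < t, (P i).2 ≠ ρ s)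
    (hinj : Set.InjOn ρ (Set.Iio t)) (hCN : ∀ s < t, (C s : Set ℤ) ⊆ Set.Ico 0 N)
    (hC : ∀ s < t, (m + t) ^ 2 < #(C s)) :
    ∃ P' : ℕ → ℤ × ℤ, IsGridConfig N (m + t) P' ∧ (∀ i < m, P' i = P i) ∧
      ∀ s < t, (P' (m + s)).1 ∈ C s ∧ (P' (m + s)).2 = ρ s := by
  induction t with
  | zero => exact ⟨P, h, fun _ _ => rfl, by simp⟩
  | succ t ih =>
    obtain ⟨P', hP', hold, hnew⟩ := ih (fun s hs => hρ s (by omega))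
      (fun i hi s hs => hρP i hi s (by omega)) (hinj.mono (Set.Iio_subset_Iio (by omega)))
      (fun s hs => hCN s (by omega))
      (fun s hs => (Nat.pow_le_pow_left (by omega) 2).trans_lt (hC s (by omega)))
    have hfresh : ∀ i < m + t, (P' i).2 ≠ ρ t := by
      intro i hi
      rcases lt_or_ge i m with him | him
      · exact hold i him ▸ hρP i him t (by omega)
      · obtain ⟨s, rfl⟩ := Nat.exists_eq_add_of_le him
        rw [(hnew s (by omega)).2]
        exact fun e => absurd (hinj (by simp; omega) (by simp) e) (by omega)
    obtain ⟨K, hK, hext⟩ := hP'.exists_forbidden_columns (hρ t (by omega)) hfresh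
    obtain ⟨x, hxC, hxK⟩ : ∃ x ∈ C t, x ∉ K := exists_mem_notMem_of_card_lt_card
      (hK.trans_lt ((Nat.pow_le_pow_left (by omega) 2).trans_lt (hC t (by omega))))
    refine ⟨update P' (m + t) (x, ρ t), hext x (hCN t (by omega) hxC) hxK, fun i hi => ?_,
      fun s hs => ?_⟩
    · rw [update_of_ne (by omega), hold i hi]
    · rcases Nat.lt_succ_iff_lt_or_eq.1 hs with hs | rfl
      · rw [update_of_ne (by omega)]
        exact hnew s hs
      · rw [update_self]
        exact ⟨hxC, rfl⟩

end IsGridConfig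

section Arcs

variable {N k u : ℕ}

/-- The reflection of the integer grid of side `N` in its horizontal axis of symmetry. -/
def reflect (N : ℕ) (p : ℤ × ℤ) : ℤ × ℤ := (p.1, N - 1 - p.2)

/-- The points of a parabolic arc at the bottom of the grid. Consecutive columns differ by about
`u`, consecutive rows by `1`. -/
def lowerArc (u i : ℕ) : ℤ × ℤ := (u * i + i ^ 2, i)

/-- The points of the mirror image, at the top of the grid of side `N`, of the lower arc. -/
def upperArc (N u j : ℕ) : ℤ × ℤ := reflect N (lowerArc u j)

theorem orient_reflect (p q r : ℤ × ℤ) :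
    orient (reflect N p) (reflect N q) (reflect N r) = -orient p q r := by
  unfold orient reflect; ring

theorem reflect_upperArc (j : ℕ) : reflect N (upperArc N u j) = lowerArc u j := by
  simp [upperArc, reflect]

theorem orient_lowerArc (i j l : ℕ) :
    orient (lowerArc u i) (lowerArc u j) (lowerArc u l) = -((j - i) * (l - i) * (l - j)) := by
  unfold orient lowerArc; ring

theorem orient_lowerArc_lowerArc_upperArc_pos {i j b : ℕ} (hij : i < j) (hj : j < k) (hb : b < k)
    (hku : k ≤ u) (hN : 8 * (u * k) ≤ N) :
    0 < orient (lowerArc u i) (lowerArc u j) (upperArc N u b) := by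
  have heq : orient (lowerArc u i) (lowerArc u j) (upperArc N u b) =
      (j - i) * ((u + j + i) * (N - 1 - b - i) - (b - i) * (u + b + i)) := by
    unfold orient upperArc reflect lowerArc; ring
  have hrow : (3 * b : ℤ) < N - 1 - b - i := by nlinarith
  rw [heq]
  refine mul_pos (by omega) (sub_pos.2 ?_)
  calc ((b - i) * (u + b + i) : ℤ) ≤ u * (3 * b) := by nlinarith
    _ < u * (N - 1 - b - i) := by gcongr; omega
    _ ≤ (u + j + i) * (N - 1 - b - i) := by gcongr <;> omega

theorem orient_lowerArc_upperArc_upperArc_neg {i a b : ℕ} (hi : i < k) (hab : a < b) (hb : b < k)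
    (hku : k ≤ u) (hN : 8 * (u * k) ≤ N) :
    orient (lowerArc u i) (upperArc N u a) (upperArc N u b) < 0 := by
  rw [← orient_rotate, ← reflect_upperArc (N := N) i, upperArc, upperArc, orient_reflect]
  exact neg_neg_of_pos (orient_lowerArc_lowerArc_upperArc_pos hab hb hi hku hN)

theorem lowerArc_fst_mem_Icc {i : ℕ} (hi : i < k) (hku : k ≤ u) (hN : 8 * (u * k) ≤ N) :
    ((lowerArc u i).1 : ℝ) ∈ Set.Icc (0 : ℝ) (N / 4) := by
  have hN' : (8 * (u * k) : ℝ) ≤ N := by exact_mod_cast hN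
  have hi' : (i : ℝ) ≤ k := by exact_mod_cast hi.le
  have hku' : (k : ℝ) ≤ u := by exact_mod_cast hku
  simp only [lowerArc, Int.cast_add, Int.cast_mul, Int.cast_natCast, Int.cast_pow]
  constructor
  · positivity
  · nlinarith

/-- The two arcs as one sequence of `2 * k` points. -/
def twoArcs (N k u i : ℕ) : ℤ × ℤ := if i < k then lowerArc u i else upperArc N u (i - k)

theorem twoArcs_of_lt {i : ℕ} (hi : i < k) : twoArcs N k u i = lowerArc u i := if_pos hi

theorem twoArcs_add (j : ℕ) : twoArcs N k u (k + j) = upperArc N u j := by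
  simp [twoArcs]

theorem twoArcs_orient_ne {i j l : ℕ} (hij : i < j) (hjl : j < l) (hl : l < 2 * k) (hku : k ≤ u)
    (hN : 8 * (u * k) ≤ N) :
    orient (twoArcs N k u i) (twoArcs N k u j) (twoArcs N k u l) ≠ 0 := by
  have hlower : ∀ {a b c : ℕ}, a < b → b < c →
      orient (lowerArc u a) (lowerArc u b) (lowerArc u c) ≠ 0 := by
    intro a b c hab hbc
    rw [orient_lowerArc, neg_ne_zero]
    exact mul_ne_zero (mul_ne_zero (by omega) (by omega)) (by omega)
  unfold twoArcs
  split_ifs with hi hj hl' hl' hj hl' hl' <;> try omega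
  · exact hlower hij hjl
  · exact (orient_lowerArc_lowerArc_upperArc_pos hij hj (by omega) hku hN).ne'
  · exact (orient_lowerArc_upperArc_upperArc_neg hi (by omega) (by omega) hku hN).ne
  · rw [upperArc, upperArc, upperArc, orient_reflect, neg_ne_zero]
    exact hlower (by omega) (by omega)

theorem isGridConfig_twoArcs (hu : 0 < u) (hku : k ≤ u) (hN : 8 * (u * k) ≤ N) :
    IsGridConfig N (2 * k) (twoArcs N k u) := by
  have hkN : 8 * k ≤ N := (by nlinarith : 8 * k ≤ 8 * (u * k)).trans hN
  have hcol : ∀ i < k, (lowerArc u i).1 ∈ Set.Ico (0 : ℤ) N := by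
    intro i hi
    simp only [lowerArc, Set.mem_Ico]
    constructor
    · positivity
    · nlinarith
  refine ⟨fun i hi => ?_, fun i hi => ?_, fun i hi j hj hij => ?_,
    fun i j l hij hjl hl => twoArcs_orient_ne hij hjl hl hku hN⟩
  · unfold twoArcs
    split_ifs with hik
    exacts [hcol i hik, hcol (i - k) (by omega)]
  · unfold twoArcs
    split_ifs <;> simp only [lowerArc, upperArc, reflect, Set.mem_Ico] <;> omega
  · rw [Set.mem_Iio] at hi hj
    simp only [twoArcs] at hij
    split_ifs at hij <;> simp only [lowerArc, upperArc, reflect] at hij <;> omega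

end Arcs

/-- A frame consists of the two arcs, followed by `k` pairs of points, one for each of the `k`
horizontal strips `k + s * u ≤ y < k + (s + 1) * u`: the line through the `s`-th pair is almost
horizontal and runs along the bottom of the `s`-th strip. -/
structure IsFrame (N k u : ℕ) (P : ℕ → ℤ × ℤ) : Prop where
  lower : ∀ i < k, P i = lowerArc u i
  upper : ∀ j < k, P (k + j) = upperArc N u j
  left_fst : ∀ s < k, 4 * (P (2 * k + 2 * s)).1 < N
  left_snd : ∀ s < k, (P (2 * k + 2 * s)).2 = k + s * u
  right_fst : ∀ s < k, 3 * N ≤ 4 * (P (2 * k + 2 * s + 1)).1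
  right_snd : ∀ s < k, (P (2 * k + 2 * s + 1)).2 = k + s * u + 1

namespace IsFrame

variable {N k u m s : ℕ} {P : ℕ → ℤ × ℤ} {x y : ℤ}

theorem orient_neg (h : IsFrame N k u P) (hs : s < k) (hx : 0 ≤ x) (hy : y < k + s * u) :
    orient (P (2 * k + 2 * s)) (P (2 * k + 2 * s + 1)) (x, y) < 0 := by
  have hl := h.left_fst s hs
  have hr := h.right_fst s hs
  simp only [orient, h.left_snd s hs, h.right_snd s hs]
  nlinarith

theorem orient_pos (h : IsFrame N k u P) (hs : s < k) (hx : x < N) (hy : k + s * u + 2 ≤ y) :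
    0 < orient (P (2 * k + 2 * s)) (P (2 * k + 2 * s + 1)) (x, y) := by
  have hl := h.left_fst s hs
  have hr := h.right_fst s hs
  simp only [orient, h.left_snd s hs, h.right_snd s hs]
  nlinarith

theorem update (h : IsFrame N k u P) (hm : 4 * k ≤ m) (p : ℤ × ℤ) :
    IsFrame N k u (Function.update P m p) := by
  have hold : ∀ i < 4 * k, Function.update P m p i = P i := fun i hi =>
    update_of_ne (by omega) _ _
  constructor
  · intro i hi; rw [hold i (by omega)]; exact h.lower i hi
  · intro j hj; rw [hold _ (by omega)]; exact h.upper j hj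
  · intro s hs; rw [hold _ (by omega)]; exact h.left_fst s hs
  · intro s hs; rw [hold _ (by omega)]; exact h.left_snd s hs
  · intro s hs; rw [hold _ (by omega)]; exact h.right_fst s hs
  · intro s hs; rw [hold _ (by omega)]; exact h.right_snd s hs

end IsFrame

section Anchors

variable {N k u : ℕ}

/-- The rows of the anchors of a frame: two consecutive ones at the bottom of each strip. -/
def anchorRow (k u t : ℕ) : ℕ := k + t / 2 * u + t % 2

/-- The admissible columns of the anchors of a frame, alternately on the left and on the right. -/
noncomputable def anchorCols (N t : ℕ) : Finset ℤ :=
  if t % 2 = 0 then Ico 0 (N / 4) else Ico (N - N / 4) N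

theorem anchorRow_two_mul (s : ℕ) : anchorRow k u (2 * s) = k + s * u := by
  simp [anchorRow]

theorem anchorRow_two_mul_add_one (s : ℕ) : anchorRow k u (2 * s + 1) = k + s * u + 1 := by
  simp [anchorRow, Nat.mul_add_div]

theorem strictMono_anchorRow (hu : 2 ≤ u) : StrictMono (anchorRow k u) := by
  refine strictMono_nat_of_lt_succ fun t => ?_
  obtain ⟨s, rfl | rfl⟩ := Nat.even_or_odd' t
  · rw [anchorRow_two_mul, anchorRow_two_mul_add_one]
    omega
  · rw [anchorRow_two_mul_add_one, (by ring : 2 * s + 1 + 1 = 2 * (s + 1)), anchorRow_two_mul]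
    linarith

theorem anchorRow_lt {t : ℕ} (ht : t < 2 * k) (hu : 2 ≤ u) : anchorRow k u t < k + k * u := by
  rw [← anchorRow_two_mul]
  exact strictMono_anchorRow hu ht

theorem anchorCols_subset (t : ℕ) : (anchorCols N t : Set ℤ) ⊆ Set.Ico 0 N := by
  unfold anchorCols
  split_ifs <;> rw [coe_Ico] <;> exact Set.Ico_subset_Ico (by omega) (by omega)

theorem card_anchorCols (t : ℕ) : #(anchorCols N t) = N / 4 := by
  unfold anchorCols
  split_ifs <;> rw [Int.card_Ico] <;> omega

theorem anchorCols_two_mul (s : ℕ) : anchorCols N (2 * s) = Ico 0 (N / 4 : ℤ) := by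
  simp [anchorCols]

theorem anchorCols_two_mul_add_one (s : ℕ) :
    anchorCols N (2 * s + 1) = Ico (N - N / 4 : ℤ) N := by
  simp [anchorCols]

theorem exists_isGridConfig_isFrame (hu : 2 ≤ u) (hku : k ≤ u) (hN : 8 * (u * k) ≤ N)
    (hcols : (4 * k) ^ 2 < N / 4) : ∃ P, IsGridConfig N (4 * k) P ∧ IsFrame N k u P := by
  have hrow : ∀ t < 2 * k, k ≤ anchorRow k u t ∧ anchorRow k u t + k < N := fun t ht =>
    ⟨by unfold anchorRow; omega, by nlinarith [anchorRow_lt ht hu]⟩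
  obtain ⟨P, hP, hold, hnew⟩ := (isGridConfig_twoArcs (by omega) hku hN).exists_append
    (fun t => anchorRow k u t) (anchorCols N) (2 * k)
    (fun t ht => by have := hrow t ht; constructor <;> omega)
    (fun i hi t ht => by
      have := hrow t ht
      unfold twoArcs
      split_ifs <;> simp only [lowerArc, upperArc, reflect] <;> omega)
    (Nat.cast_injective.comp (strictMono_anchorRow hu).injective).injOn
    (fun t _ => anchorCols_subset t)
    (fun t _ => by rwa [card_anchorCols, ← two_mul, ← mul_assoc])
  have hleft := fun s (hs : s < k) => hnew (2 * s) (by omega)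
  have hright := fun s (hs : s < k) => hnew (2 * s + 1) (by omega)
  simp only [anchorCols_two_mul, anchorRow_two_mul, mem_Ico] at hleft
  simp only [anchorCols_two_mul_add_one, anchorRow_two_mul_add_one, mem_Ico] at hright
  refine ⟨P, by rwa [← two_mul, ← mul_assoc] at hP, fun i hi => ?_, fun j hj => ?_,
    fun s hs => ?_, fun s hs => ?_, fun s hs => ?_, fun s hs => ?_⟩
  · rw [hold i (by omega), twoArcs_of_lt hi]
  · rw [hold _ (by omega), twoArcs_add]
  · have := (hleft s hs).1; omega
  · exact_mod_cast (hleft s hs).2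
  · have := (hright s hs).1; rw [← add_assoc] at this; omega
  · exact_mod_cast (hright s hs).2

end Anchors

section Affine

variable {f : ℝ → ℝ} {c N y : ℝ}

theorem abs_sub_abs_le_two_mul_abs (hf : ∀ y z, f y - f z = c * (y - z)) (hy : 0 ≤ y)
    (hyN : 2 * y ≤ N) : |f 0| - |f N| ≤ 2 * |f y| := by
  have hbot : |f 0| - |f y| ≤ |c| * y := by
    simpa [hf, abs_mul, abs_of_nonneg hy] using abs_sub_abs_le_abs_sub (f 0) (f y)
  have htop : |c| * (N - y) ≤ |f N| + |f y| := by
    simpa [hf, abs_mul, abs_of_nonneg (by linarith : 0 ≤ N - y)] using abs_sub (f N) (f y)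
  have hmid : |c| * y ≤ |c| * (N - y) := by gcongr; linarith
  linarith

theorem abs_sub_mul_abs_sub_le {z δ : ℝ} (hf : ∀ y z, f y - f z = c * (y - z))
    (hy : y ∈ Set.Icc 0 N) (hfy : |f y| < δ) (hfz : |f z| < δ) :
    (|f N| - δ) * |y - z| ≤ 2 * δ * N := by
  have htop : |f N| - δ ≤ |c| * N := by
    calc |f N| - δ ≤ |f N| - |f y| := by gcongr
      _ ≤ |f N - f y| := abs_sub_abs_le_abs_sub _ _
      _ = |c| * (N - y) := by rw [hf, abs_mul, abs_of_nonneg (sub_nonneg.2 hy.2)]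
      _ ≤ |c| * N := by gcongr; exact sub_le_self N hy.1
  have hdiff : |c| * |y - z| ≤ 2 * δ := by
    rw [← abs_mul, ← hf]
    linarith [abs_sub (f y) (f z)]
  have hN : 0 ≤ N := hy.1.trans hy.2
  calc (|f N| - δ) * |y - z| ≤ |c| * N * |y - z| := by gcongr
    _ = |c| * |y - z| * N := by ring
    _ ≤ 2 * δ * N := by gcongr

end Affine

/-- The inverse slope of the line through `p` and `q`: the displacement of its crossing with a row
when the row moves up by one. It is meaningful when `p` and `q` have different heights. -/
noncomputable def inverseSlope (p q : ℤ × ℤ) : ℝ := (q.1 - p.1) / (q.2 - p.2)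

theorem rowCrossing_sub_rowCrossing (p q : ℤ × ℤ) (y z : ℝ) :
    rowCrossing p q y - rowCrossing p q z = inverseSlope p q * (y - z) := by
  unfold rowCrossing inverseSlope; ring

theorem rowCrossing_left (p q : ℤ × ℤ) : rowCrossing p q p.2 = p.1 := by
  simp [rowCrossing]

theorem rowCrossing_right {p q : ℤ × ℤ} (h : p.2 < q.2) : rowCrossing p q q.2 = q.1 := by
  have hne : (q.2 - p.2 : ℝ) ≠ 0 := sub_ne_zero.2 (by exact_mod_cast h.ne')
  unfold rowCrossing
  field_simp
  ring

/-- The crossing with the row `y` of the line joining the point `p.1` of the lower arc to the point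
`p.2` of the upper arc. -/
noncomputable def crossing (N u : ℕ) {k : ℕ} (p : Fin k × Fin k) (y : ℝ) : ℝ :=
  rowCrossing (lowerArc u p.1) (upperArc N u p.2) y

section Crossing

variable {N u k : ℕ} {p q : Fin k × Fin k} {y z δ : ℝ}

theorem lowerArc_snd_lt_upperArc_snd (hN : 8 * k ≤ N) (i j : Fin k) :
    (lowerArc u i).2 < (upperArc N u j).2 := by
  simp only [lowerArc, upperArc, reflect]
  omega

theorem crossing_mem_Icc (hku : k ≤ u) (hN : 8 * (u * k) ≤ N) (p : Fin k × Fin k)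
    (hy : y ∈ Set.Icc (k : ℝ) (N - k)) : crossing N u p y ∈ Set.Icc (0 : ℝ) (N / 4) := by
  have hk := p.1.pos
  have hkN : 8 * k ≤ N := (by nlinarith : 8 * k ≤ 8 * (u * k)).trans hN
  have hlow : ((p.1 : ℕ) : ℝ) ≤ k := by exact_mod_cast p.1.is_le'
  have hupp : ((p.2 : ℕ) : ℝ) + 1 ≤ k := by exact_mod_cast p.2.is_lt
  refine rowCrossing_mem_Icc (lowerArc_snd_lt_upperArc_snd hkN p.1 p.2) ?_
    (lowerArc_fst_mem_Icc p.1.is_lt hku hN) (lowerArc_fst_mem_Icc p.2.is_lt hku hN)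
  simp only [lowerArc, upperArc, reflect, Set.mem_Icc]
  push_cast
  exact ⟨by linarith [hy.1], by linarith [hy.2]⟩

theorem abs_inverseSlope_le (hku : k ≤ u) (hN : 8 * (u * k) ≤ N) (i j : Fin k) :
    |inverseSlope (lowerArc u i) (upperArc N u j)| ≤ 1 / 2 := by
  have hk := i.pos
  have hkN : (8 * k : ℝ) ≤ N := by exact_mod_cast (by nlinarith : 8 * k ≤ 8 * (u * k)).trans hN
  have hi : ((i : ℕ) : ℝ) + 1 ≤ k := by exact_mod_cast i.is_lt
  have hj : ((j : ℕ) : ℝ) + 1 ≤ k := by exact_mod_cast j.is_lt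
  have hwidth : |((lowerArc u j).1 - (lowerArc u i).1 : ℝ)| ≤ N / 4 := by
    obtain ⟨hi0, hi1⟩ := lowerArc_fst_mem_Icc i.is_lt hku hN
    obtain ⟨hj0, hj1⟩ := lowerArc_fst_mem_Icc j.is_lt hku hN
    exact abs_sub_le_iff.2 ⟨by linarith, by linarith⟩
  have hheight : (N / 2 : ℝ) ≤ (upperArc N u j).2 - (lowerArc u i).2 := by
    simp only [lowerArc, upperArc, reflect]
    push_cast
    linarith
  have hheight_pos : (0 : ℝ) < (upperArc N u j).2 - (lowerArc u i).2 := by linarith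
  rw [inverseSlope, abs_div, abs_of_pos hheight_pos, div_le_iff₀ hheight_pos]
  exact hwidth.trans (by linarith)

theorem abs_crossing_zero_sub_le (hku : k ≤ u) (hN : 8 * (u * k) ≤ N) (p : Fin k × Fin k) :
    |crossing N u p 0 - (lowerArc u p.1).1| ≤ k / 2 := by
  have hi : ((p.1 : ℕ) : ℝ) ≤ k := by exact_mod_cast p.1.is_le'
  rw [crossing, ← rowCrossing_left _ (upperArc N u p.2), rowCrossing_sub_rowCrossing, abs_mul]
  calc _ ≤ 1 / 2 * |0 - ((lowerArc u p.1).2 : ℝ)| := by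
        gcongr; exact abs_inverseSlope_le hku hN p.1 p.2
    _ = p.1 / 2 := by simp [lowerArc]; ring
    _ ≤ k / 2 := by gcongr

theorem abs_crossing_top_sub_le (hku : k ≤ u) (hN : 8 * (u * k) ≤ N) (p : Fin k × Fin k) :
    |crossing N u p N - (lowerArc u p.2).1| ≤ k / 2 := by
  have hk := p.1.pos
  have hkN : 8 * k ≤ N := (by nlinarith : 8 * k ≤ 8 * (u * k)).trans hN
  have hj : ((p.2 : ℕ) : ℝ) + 1 ≤ k := by exact_mod_cast p.2.is_lt
  have hright : rowCrossing (lowerArc u p.1) (upperArc N u p.2) (upperArc N u p.2).2 =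
      (lowerArc u p.2).1 := rowCrossing_right (lowerArc_snd_lt_upperArc_snd hkN p.1 p.2)
  rw [crossing, ← hright, rowCrossing_sub_rowCrossing, abs_mul]
  calc _ ≤ 1 / 2 * |(N : ℝ) - (upperArc N u p.2).2| := by
        gcongr; exact abs_inverseSlope_le hku hN p.1 p.2
    _ = (p.2 + 1) / 2 := by
        simp only [upperArc, reflect, lowerArc]
        push_cast
        rw [abs_of_nonneg (by linarith)]
        ring
    _ ≤ k / 2 := by gcongr

theorem mul_abs_sub_le_abs_lowerArc_sub (i j : ℕ) :
    (u * |(i - j : ℝ)|) ≤ |((lowerArc u i).1 - (lowerArc u j).1 : ℝ)| := by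
  have hfactor : ((lowerArc u i).1 - (lowerArc u j).1 : ℝ) = (u + (i + j)) * (i - j) := by
    simp only [lowerArc]; push_cast; ring
  have hsum : (0 : ℝ) ≤ i + j := by positivity
  rw [hfactor, abs_mul]
  gcongr
  exact (le_add_of_nonneg_right hsum).trans (le_abs_self _)

theorem crossing_sub_crossing (p q : Fin k × Fin k) : ∃ c, ∀ y z : ℝ,
    (crossing N u p y - crossing N u q y) - (crossing N u p z - crossing N u q z) =
      c * (y - z) := by
  refine ⟨inverseSlope (lowerArc u p.1) (upperArc N u p.2) -
    inverseSlope (lowerArc u q.1) (upperArc N u q.2), fun y z => ?_⟩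
  rw [sub_mul, ← rowCrossing_sub_rowCrossing, ← rowCrossing_sub_rowCrossing, crossing, crossing,
    crossing, crossing]
  ring

theorem abs_crossing_sub_zero_sub_le (hku : k ≤ u) (hN : 8 * (u * k) ≤ N) (p q : Fin k × Fin k) :
    |crossing N u p 0 - crossing N u q 0 - ((lowerArc u p.1).1 - (lowerArc u q.1).1)| ≤ k := by
  have hp := abs_crossing_zero_sub_le hku hN p
  have hq := abs_crossing_zero_sub_le hku hN q
  rw [sub_sub_sub_comm]
  linarith [abs_sub (crossing N u p 0 - (lowerArc u p.1).1)
    (crossing N u q 0 - (lowerArc u q.1).1)]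

theorem abs_crossing_sub_top_sub_le (hku : k ≤ u) (hN : 8 * (u * k) ≤ N) (p q : Fin k × Fin k) :
    |crossing N u p N - crossing N u q N - ((lowerArc u p.2).1 - (lowerArc u q.2).1)| ≤ k := by
  have hp := abs_crossing_top_sub_le hku hN p
  have hq := abs_crossing_top_sub_le hku hN q
  rw [sub_sub_sub_comm]
  linarith [abs_sub (crossing N u p N - (lowerArc u p.2).1)
    (crossing N u q N - (lowerArc u q.2).1)]

theorem one_le_abs_sub_of_ne {i j : Fin k} (h : i ≠ j) : 1 ≤ |((i : ℕ) - (j : ℕ) : ℝ)| := by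
  have : 1 ≤ |((i : ℕ) - (j : ℕ) : ℤ)| := Int.one_le_abs (by omega)
  exact_mod_cast this

theorem le_abs_crossing_sub_of_snd_eq (hδ : 2 * (k + δ) ≤ u) (hku : k ≤ u) (hN : 8 * (u * k) ≤ N)
    (hsnd : p.2 = q.2) (hfst : p.1 ≠ q.1) (hy : 0 ≤ y) (hyN : 2 * y ≤ N) :
    δ ≤ |crossing N u p y - crossing N u q y| := by
  obtain ⟨c, hc⟩ := crossing_sub_crossing (N := N) (u := u) p q
  have hbot := abs_crossing_sub_zero_sub_le hku hN p q
  have htop := abs_crossing_sub_top_sub_le hku hN p q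
  rw [hsnd, sub_self, sub_zero] at htop
  have hsep : (u : ℝ) ≤ |((lowerArc u p.1).1 - (lowerArc u q.1).1 : ℝ)| :=
    (le_mul_of_one_le_right u.cast_nonneg (one_le_abs_sub_of_ne hfst)).trans
      (mul_abs_sub_le_abs_lowerArc_sub _ _)
  rw [abs_sub_comm] at hbot
  linarith [abs_sub_abs_le_two_mul_abs hc hy hyN, abs_sub_abs_le_abs_sub
    ((lowerArc u p.1).1 - (lowerArc u q.1).1 : ℝ) (crossing N u p 0 - crossing N u q 0)]

theorem mul_abs_sub_le_of_abs_crossing_sub_lt (hδ : 2 * (k + δ) ≤ u) (hku : k ≤ u)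
    (hN : 8 * (u * k) ≤ N) (hy : y ∈ Set.Icc (0 : ℝ) N)
    (hpqy : |crossing N u p y - crossing N u q y| < δ)
    (hpqz : |crossing N u p z - crossing N u q z| < δ) :
    u * |((p.2 : ℕ) - (q.2 : ℕ) : ℝ)| * |y - z| ≤ 4 * δ * N := by
  obtain ⟨c, hc⟩ := crossing_sub_crossing (N := N) (u := u) p q
  have hδ₀ : 0 ≤ δ := (abs_nonneg _).trans hpqy.le
  rcases eq_or_ne p.2 q.2 with h | h
  · simp only [h, sub_self, abs_zero, mul_zero, zero_mul]
    positivity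
  have htop := abs_crossing_sub_top_sub_le hku hN p q
  have hsep := mul_abs_sub_le_abs_lowerArc_sub (u := u) p.2 q.2
  have hgap : u * |((p.2 : ℕ) - (q.2 : ℕ) : ℝ)| ≤
      2 * (|crossing N u p N - crossing N u q N| - δ) := by
    have hu := le_mul_of_one_le_right u.cast_nonneg (one_le_abs_sub_of_ne h)
    rw [abs_sub_comm] at htop
    linarith [abs_sub_abs_le_abs_sub
      ((lowerArc u p.2).1 - (lowerArc u q.2).1 : ℝ) (crossing N u p N - crossing N u q N)]
  calc _ ≤ 2 * (|crossing N u p N - crossing N u q N| - δ) * |y - z| := by gcongr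
    _ = 2 * ((|crossing N u p N - crossing N u q N| - δ) * |y - z|) := mul_assoc _ _ _
    _ ≤ 2 * (2 * δ * N) := by gcongr 2 * ?_; exact abs_sub_mul_abs_sub_le hc hy hpqy hpqz
    _ = 4 * δ * N := by ring

end Crossing

theorem mul_card_le_of_mul_abs_sub_le {S : Finset ℕ} {w D : ℝ} (hw : 0 ≤ w) (hD : 0 ≤ D)
    (h : ∀ y ∈ S, ∀ z ∈ S, w * |(y - z : ℝ)| ≤ D) : w * #S ≤ D + w := by
  rcases S.eq_empty_or_nonempty with rfl | hS
  · simp only [card_empty, Nat.cast_zero, mul_zero]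
    positivity
  have hcard : (#S : ℝ) ≤ S.max' hS - S.min' hS + 1 := by
    have hle := S.min'_le _ (S.max'_mem hS)
    have hsub : S ⊆ Icc (S.min' hS) (S.max' hS) := fun y hy =>
      mem_Icc.2 ⟨S.min'_le y hy, S.le_max' y hy⟩
    have hIcc := card_le_card hsub
    rw [Nat.card_Icc] at hIcc
    rw [← Nat.cast_sub hle]
    exact_mod_cast (by omega : #S ≤ S.max' hS - S.min' hS + 1)
  calc w * #S ≤ w * (S.max' hS - S.min' hS + 1) := by gcongr
    _ = w * (S.max' hS - S.min' hS : ℝ) + w := by ring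
    _ ≤ w * |(S.max' hS - S.min' hS : ℝ)| + w := by gcongr; exact le_abs_self _
    _ ≤ D + w := by gcongr; exact h _ (S.max'_mem hS) _ (S.min'_mem hS)

theorem sum_inv_succ_le {m k : ℕ} (h : m ≤ k) :
    ∑ i ∈ range m, ((i : ℝ) + 1)⁻¹ ≤ 1 + Real.log k := by
  calc ∑ i ∈ range m, ((i : ℝ) + 1)⁻¹ ≤ ∑ i ∈ range k, ((i : ℝ) + 1)⁻¹ :=
        sum_le_sum_of_subset_of_nonneg (range_mono h) fun i _ _ => by positivity
    _ = (harmonic k : ℝ) := by simp [harmonic]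
    _ ≤ 1 + Real.log k := harmonic_le_one_add_log k

theorem sum_inv_abs_sub_le {j k : ℕ} (hj : j ≤ k) :
    ∑ i ∈ range k, |(j - i : ℝ)|⁻¹ ≤ 2 * (1 + Real.log k) := by
  obtain ⟨l, rfl⟩ := Nat.exists_eq_add_of_le hj
  have hleft : ∑ i ∈ range j, |(j - i : ℝ)|⁻¹ = ∑ i ∈ range j, ((i : ℝ) + 1)⁻¹ := by
    rw [← sum_range_reflect]
    refine sum_congr rfl fun i hi => ?_
    have hi' : i + 1 ≤ j := mem_range.1 hi
    rw [Nat.sub_sub, add_comm 1 i, Nat.cast_sub hi', sub_sub_cancel, abs_of_nonneg (by positivity)]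
    push_cast
    rfl
  have hright : ∑ i ∈ range l, |(j - (j + i : ℕ) : ℝ)|⁻¹ ≤ ∑ i ∈ range l, ((i : ℝ) + 1)⁻¹ := by
    have hterm : ∀ i : ℕ, |(j - (j + i : ℕ) : ℝ)|⁻¹ = (i : ℝ)⁻¹ := fun i => by simp
    simp only [hterm]
    cases l with
    | zero => simp
    | succ l =>
      rw [sum_range_succ', Nat.cast_zero, inv_zero, add_zero, sum_range_succ]
      simp only [Nat.cast_add, Nat.cast_one]
      exact le_add_of_nonneg_right (by positivity)
  rw [sum_range_add, hleft]
  linarith [sum_inv_succ_le (Nat.le_add_right j l), sum_inv_succ_le (Nat.le_add_left l j)]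

/-- The pairs of lines between the two arcs whose crossings with the row `y` are at distance less
than `δ`. -/
noncomputable def closePairs (N u k : ℕ) (δ y : ℝ) :
    Finset ((Fin k × Fin k) × (Fin k × Fin k)) :=
  {c | |crossing N u c.1 y - crossing N u c.2 y| < δ}

theorem mem_closePairs {N u k : ℕ} {δ y : ℝ} {c : (Fin k × Fin k) × (Fin k × Fin k)} :
    c ∈ closePairs N u k δ y ↔ |crossing N u c.1 y - crossing N u c.2 y| < δ := by
  simp [closePairs]

section ClosePairs

variable {N u k : ℕ} {δ : ℝ} {R : Finset ℕ}

/-- Since `0⁻¹ = 0`, the second summand vanishes for pairs of lines with a common upper point. -/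
theorem card_filter_mem_closePairs_le (hδ : 1 ≤ δ) (hu : 2 * (k + δ) ≤ u) (hN : 8 * (u * k) ≤ N)
    (hR : ∀ y ∈ R, 2 * y ≤ N) (c : (Fin k × Fin k) × (Fin k × Fin k)) :
    (#{y ∈ R | c ∈ closePairs N u k δ (y : ℕ)} : ℝ) ≤ (if c.1 = c.2 then (#R : ℝ) else 0) +
      5 * δ * N / u * |((c.1.2 : ℕ) - (c.2.2 : ℕ) : ℝ)|⁻¹ := by
  obtain ⟨p, q⟩ := c
  have hku : k ≤ u := by exact_mod_cast (by linarith : (k : ℝ) ≤ u)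
  have hRN : ∀ y ∈ R, 2 * (y : ℝ) ≤ N := fun y hy => by exact_mod_cast hR y hy
  rcases eq_or_ne p q with rfl | hpq
  · rw [if_pos rfl]
    exact le_add_of_le_of_nonneg (by exact_mod_cast card_filter_le _ _) (by positivity)
  rw [if_neg hpq, zero_add]
  rcases eq_or_ne p.2 q.2 with hsnd | hsnd
  · have hempty : {y ∈ R | (p, q) ∈ closePairs N u k δ (y : ℕ)} = ∅ :=
      filter_false_of_mem fun y hy => mem_closePairs.not.2 <| not_lt.2 <|
        le_abs_crossing_sub_of_snd_eq hu hku hN hsnd (fun h => hpq (Prod.ext h hsnd))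
          (Nat.cast_nonneg y) (hRN y hy)
    simp [hempty, hsnd]
  · have hdist_pos := one_pos.trans_le (one_le_abs_sub_of_ne hsnd)
    set w : ℝ := u * |((p.2 : ℕ) - (q.2 : ℕ) : ℝ)| with hw
    have hwpos : 0 < w := mul_pos (by linarith [(Nat.cast_nonneg k : (0 : ℝ) ≤ k)]) hdist_pos
    have hwN : w ≤ δ * N := by
      have hdist : |((p.2 : ℕ) - (q.2 : ℕ) : ℝ)| ≤ k :=
        abs_sub_le_of_nonneg_of_le p.2.val.cast_nonneg (by exact_mod_cast p.2.is_le')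
          q.2.val.cast_nonneg (by exact_mod_cast q.2.is_le')
      have hNk : (u * k : ℝ) ≤ N := by exact_mod_cast (by omega : u * k ≤ N)
      calc w ≤ u * k := by rw [hw]; gcongr
        _ ≤ N := hNk
        _ ≤ δ * N := le_mul_of_one_le_left N.cast_nonneg hδ
    have hcard := mul_card_le_of_mul_abs_sub_le (S := {y ∈ R | (p, q) ∈ closePairs N u k δ (y : ℕ)})
      (D := 4 * δ * N) hwpos.le (by positivity) fun y hy z hz => by
        rw [mem_filter, mem_closePairs] at hy hz
        exact mul_abs_sub_le_of_abs_crossing_sub_lt hu hku hN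
          ⟨y.cast_nonneg, by linarith [hRN y hy.1, (Nat.cast_nonneg y : (0 : ℝ) ≤ y)]⟩ hy.2 hz.2
    calc _ ≤ 5 * δ * N / w := (le_div_iff₀' hwpos).2 (by linarith)
      _ = _ := by rw [hw, div_mul_eq_div_div, div_eq_mul_inv (_ / _)]

theorem sum_inv_abs_snd_sub_le :
    ∑ c : (Fin k × Fin k) × (Fin k × Fin k), |((c.1.2 : ℕ) - (c.2.2 : ℕ) : ℝ)|⁻¹ ≤
      2 * k ^ 3 * (1 + Real.log k) := by
  simp only [Fintype.sum_prod_type, sum_const, card_univ, Fintype.card_fin, nsmul_eq_mul]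
  have hsum : ∀ j : Fin k, ∑ i : Fin k, |((j : ℕ) - (i : ℕ) : ℝ)|⁻¹ ≤ 2 * (1 + Real.log k) := by
    intro j
    rw [Fin.sum_univ_eq_sum_range fun i => |((j : ℕ) - (i : ℕ) : ℝ)|⁻¹]
    exact sum_inv_abs_sub_le j.is_le'
  calc _ ≤ (k : ℝ) * ∑ j : Fin k, (k : ℝ) * (2 * (1 + Real.log k)) := by
        gcongr; exact hsum _
    _ = 2 * k ^ 3 * (1 + Real.log k) := by
        rw [sum_const, card_univ, Fintype.card_fin, nsmul_eq_mul]
        ring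

theorem sum_card_closePairs_le (hδ : 1 ≤ δ) (hu : 2 * (k + δ) ≤ u) (hN : 8 * (u * k) ≤ N)
    (hlog : 10 * δ * k * (1 + Real.log k) ≤ u) (hR : ∀ y ∈ R, 2 * y ≤ N) :
    ∑ y ∈ R, #(closePairs N u k δ (y : ℕ)) ≤ k ^ 2 * (#R + N) := by
  have hupos : (0 : ℝ) < u := by linarith [(Nat.cast_nonneg k : (0 : ℝ) ≤ k)]
  have hdiag : ∑ c : (Fin k × Fin k) × (Fin k × Fin k), (if c.1 = c.2 then (#R : ℝ) else 0) =
      k ^ 2 * #R := by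
    rw [Fintype.sum_prod_type]
    simp [sq]
  have hreal : (∑ y ∈ R, #(closePairs N u k δ (y : ℕ)) : ℝ) ≤ k ^ 2 * (#R + N) := by
    calc (∑ y ∈ R, #(closePairs N u k δ (y : ℕ)) : ℝ)
        = ∑ c, (#{y ∈ R | c ∈ closePairs N u k δ (y : ℕ)} : ℝ) := by
          have hcount := sum_card_bipartiteAbove_eq_sum_card_bipartiteBelow (s := R) (t := univ)
            fun y c => c ∈ closePairs N u k δ (y : ℕ)
          simp only [bipartiteAbove, bipartiteBelow, filter_univ_mem] at hcount
          exact_mod_cast hcount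
      _ ≤ ∑ c : (Fin k × Fin k) × (Fin k × Fin k), ((if c.1 = c.2 then (#R : ℝ) else 0) +
            5 * δ * N / u * |((c.1.2 : ℕ) - (c.2.2 : ℕ) : ℝ)|⁻¹) :=
          sum_le_sum fun c _ => card_filter_mem_closePairs_le hδ hu hN hR c
      _ ≤ k ^ 2 * #R + 5 * δ * N / u * (2 * k ^ 3 * (1 + Real.log k)) := by
          rw [sum_add_distrib, hdiag, ← mul_sum]
          gcongr
          exact sum_inv_abs_snd_sub_le
      _ = k ^ 2 * #R + k ^ 2 * N * (10 * δ * k * (1 + Real.log k) / u) := by ring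
      _ ≤ k ^ 2 * #R + k ^ 2 * N * 1 := by
          gcongr
          exact (div_le_one hupos).2 hlog
      _ = k ^ 2 * (#R + N) := by ring
  exact_mod_cast hreal

end ClosePairs

theorem exists_separated_subset (V : Finset ℝ) {δ : ℝ} (hδ : 0 < δ) :
    ∃ W ⊆ V, (W : Set ℝ).Pairwise (fun v w => δ ≤ |v - w|) ∧ ∀ v ∈ V, ∃ w ∈ W, |v - w| < δ := by
  induction V using Finset.induction_on with
  | empty => exact ⟨∅, by simp⟩
  | insert v V hv ih =>
    obtain ⟨W, hWV, hsep, hcover⟩ := ih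
    by_cases hfar : ∃ w ∈ W, |v - w| < δ
    · refine ⟨W, hWV.trans (subset_insert v V), hsep, fun v' hv' => ?_⟩
      rcases mem_insert.1 hv' with rfl | hv'
      exacts [hfar, hcover v' hv']
    · push Not at hfar
      refine ⟨insert v W, insert_subset_insert v hWV, ?_, fun v' hv' => ?_⟩
      · rw [coe_insert]
        exact hsep.insert fun w hw _ => ⟨hfar w hw, abs_sub_comm v w ▸ hfar w hw⟩
      · rcases mem_insert.1 hv' with rfl | hv'
        · exact ⟨v', mem_insert_self v' W, by simpa using hδ⟩
        · obtain ⟨w, hw, hvw⟩ := hcover v' hv'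
          exact ⟨w, mem_insert_of_mem hw, hvw⟩

theorem sq_card_le_card_mul_card_collisions {ι κ : Type*} [DecidableEq κ] {s : Finset ι}
    {t : Finset κ} {f : ι → κ} (hf : ∀ i ∈ s, f i ∈ t) :
    #s ^ 2 ≤ #t * #{c ∈ s ×ˢ s | f c.1 = f c.2} := by
  have hcollisions : #{c ∈ s ×ˢ s | f c.1 = f c.2} = ∑ b ∈ t, #{i ∈ s | f i = b} ^ 2 := by
    rw [card_eq_sum_card_fiberwise (f := fun c => f c.1) (t := t)
      fun c hc => hf c.1 (by simp at hc; tauto)]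
    refine sum_congr rfl fun b _ => ?_
    rw [sq, ← card_product]
    congr 1
    ext c
    simp only [mem_filter, mem_product]
    grind
  rw [hcollisions, card_eq_sum_card_fiberwise hf]
  exact sq_sum_le_card_mul_sum_sq

theorem exists_separated_crossings (N u k : ℕ) {d : ℝ} (hd : 0 < d) (y : ℝ) :
    ∃ W : Finset ℝ, (∀ w ∈ W, ∃ p : Fin k × Fin k, crossing N u p y = w) ∧
      (W : Set ℝ).Pairwise (fun v w => d ≤ |v - w|) ∧
      k ^ 4 ≤ #W * #(closePairs N u k (2 * d) y) := by
  obtain ⟨W, hWV, hsep, hcover⟩ :=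
    exists_separated_subset (univ.image fun p : Fin k × Fin k => crossing N u p y) hd
  simp only [mem_image, mem_univ, true_and, forall_exists_index, forall_apply_eq_imp_iff]
    at hcover
  choose nearest hmem hnear using hcover
  refine ⟨W, fun w hw => by simpa using hWV hw, hsep, ?_⟩
  calc k ^ 4 = #(univ : Finset (Fin k × Fin k)) ^ 2 := by simp; ring
    _ ≤ #W * #{c ∈ univ ×ˢ univ | nearest c.1 = nearest c.2} :=
        sq_card_le_card_mul_card_collisions fun p _ => hmem p
    _ ≤ #W * #(closePairs N u k (2 * d) y) := by
        gcongr
        intro c hc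
        have heq : nearest c.1 = nearest c.2 := (mem_filter.1 hc).2
        have hfst : |crossing N u c.1 y - nearest c.2| < d := heq ▸ hnear c.1
        have hsnd : |nearest c.2 - crossing N u c.2 y| < d := by
          rw [abs_sub_comm]
          exact hnear c.2
        rw [mem_closePairs]
        linarith [abs_sub_le (crossing N u c.1 y) (nearest c.2) (crossing N u c.2 y)]

section Columns

variable {d : ℕ} {W : Finset ℝ} (hsep : (W : Set ℝ).Pairwise fun v w => (d : ℝ) ≤ |v - w|)
include hsep

theorem add_le_of_separated {v w : ℝ} (hv : v ∈ W) (hw : w ∈ W) (h : v < w) : v + d ≤ w := by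
  have habs : (d : ℝ) ≤ |v - w| := hsep hv hw h.ne
  rw [abs_sub_comm, abs_of_pos (sub_pos.2 h)] at habs
  linarith

theorem pairwiseDisjoint_Ico_ceil :
    (W : Set ℝ).PairwiseDisjoint fun w => Ico ⌈w⌉ (⌈w⌉ + d) := by
  have hordered : ∀ v ∈ W, ∀ w ∈ W, v < w → Disjoint (Ico ⌈v⌉ (⌈v⌉ + d)) (Ico ⌈w⌉ (⌈w⌉ + d)) := by
    intro v hv w hw hvw
    have hle : ⌈v⌉ + d ≤ ⌈w⌉ := by
      rw [← Int.ceil_add_natCast]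
      exact Int.ceil_le_ceil (add_le_of_separated hsep hv hw hvw)
    exact disjoint_left.2 fun x hxv hxw => by
      rw [mem_Ico] at hxv hxw
      omega
  intro v hv w hw hvw
  rcases hvw.lt_or_gt with h | h
  exacts [hordered v hv w hw h, (hordered w hw v hv h).symm]

theorem mul_card_blocked_le (K : Finset ℤ) :
    d * #{w ∈ W | Ico ⌈w⌉ (⌈w⌉ + d) ⊆ K} ≤ #K := by
  calc d * #{w ∈ W | Ico ⌈w⌉ (⌈w⌉ + d) ⊆ K}
      = ∑ w ∈ W with Ico ⌈w⌉ (⌈w⌉ + d) ⊆ K, #(Ico ⌈w⌉ (⌈w⌉ + d)) := by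
        simp [mul_comm]
    _ = #({w ∈ W | Ico ⌈w⌉ (⌈w⌉ + d) ⊆ K}.biUnion fun w => Ico ⌈w⌉ (⌈w⌉ + d)) :=
        (card_biUnion fun v hv w hw hvw => pairwiseDisjoint_Ico_ceil hsep
          (mem_of_mem_filter v hv) (mem_of_mem_filter w hw) hvw).symm
    _ ≤ #K := card_le_card (biUnion_subset.2 fun w hw => (mem_filter.1 hw).2)

theorem exists_interleaved_columns (K : Finset ℤ) :
    ∃ X : Finset ℤ, d * #W ≤ d * #X + #K ∧ (∀ x ∈ X, x ∉ K) ∧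
      (∀ x ∈ X, ∃ w ∈ W, w ≤ x ∧ x < w + d) ∧
      ∀ x ∈ X, ∀ x' ∈ X, x < x' → ∃ w ∈ W, x < w ∧ w ≤ x' := by
  have hfree : ∀ w : ℝ, ¬ Ico ⌈w⌉ (⌈w⌉ + d) ⊆ K → ∃ x : ℤ, x ∉ K ∧ w ≤ x ∧ x < w + d := by
    intro w hw
    obtain ⟨x, hx, hxK⟩ := not_subset.1 hw
    rw [mem_Ico] at hx
    have hlt : x < ⌈w + d⌉ := by rw [Int.ceil_add_natCast]; exact hx.2
    exact ⟨x, hxK, Int.ceil_le.1 hx.1, Int.lt_ceil.1 hlt⟩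
  choose! col hcolK hcol hcol' using hfree
  let W' : Finset ℝ := {w ∈ W | ¬ Ico ⌈w⌉ (⌈w⌉ + d) ⊆ K}
  have hmono : ∀ v ∈ W', ∀ w ∈ W', v < w → (col v : ℝ) < w := fun v hv w hw hvw =>
    (hcol' v (mem_filter.1 hv).2).trans_le
      (add_le_of_separated hsep (mem_filter.1 hv).1 (mem_filter.1 hw).1 hvw)
  have hstrict : StrictMonoOn col W' := fun v hv w hw hvw => by
    exact_mod_cast (hmono v hv w hw hvw).trans_le (hcol w (mem_filter.1 hw).2)
  refine ⟨W'.image col, ?_, ?_, ?_, ?_⟩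
  · rw [card_image_of_injOn hstrict.injOn,
      ← card_filter_add_card_filter_not (s := W) (fun w => Ico ⌈w⌉ (⌈w⌉ + d) ⊆ K)]
    linarith [mul_card_blocked_le hsep K]
  · simp only [forall_mem_image]
    exact fun w hw => hcolK w (mem_filter.1 hw).2
  · simp only [forall_mem_image]
    exact fun w hw => ⟨w, (mem_filter.1 hw).1, hcol w (mem_filter.1 hw).2,
      hcol' w (mem_filter.1 hw).2⟩
  · simp only [forall_mem_image]
    intro v hv w hw hvw
    exact ⟨w, (mem_filter.1 hw).1, hmono v hv w hw ((hstrict.lt_iff_lt hv hw).1 hvw),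
      hcol w (mem_filter.1 hw).2⟩

end Columns

theorem exists_distinguished_columns {N u k d T q : ℕ} {y : ℝ} {K : Finset ℤ} (hk : 0 < k)
    (hd : 0 < d) (hu : 2 * (k + 2 * d) ≤ u) (hN : 8 * (u * k) ≤ N)
    (hy : y ∈ Set.Icc (k : ℝ) (N - k)) (hclose : #(closePairs N u k (2 * d) y) ≤ T * k ^ 2)
    (hq : 2 * T * q ≤ k ^ 2) (hK : #K ≤ d * q) :
    ∃ X : Finset ℤ, q ≤ #X ∧ (∀ x ∈ X, x ∈ Set.Ico (0 : ℤ) N ∧ x ∉ K) ∧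
      ∀ x ∈ X, ∀ x' ∈ X, x < x' →
        ∃ p : Fin k × Fin k, x < crossing N u p y ∧ crossing N u p y ≤ x' := by
  obtain ⟨W, hWcross, hsep, hcard⟩ :=
    exists_separated_crossings N u k (Nat.cast_pos.2 hd : (0 : ℝ) < d) y
  obtain ⟨X, hX, hXK, hXnear, hXsep⟩ := exists_interleaved_columns hsep K
  have hW : 2 * q ≤ #W := by
    have : k ^ 2 * k ^ 2 ≤ k ^ 2 * (T * #W) := by nlinarith
    have := Nat.le_of_mul_le_mul_left this (by positivity)
    rcases Nat.eq_zero_or_pos T with rfl | hT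
    · nlinarith
    · exact Nat.le_of_mul_le_mul_left (by linarith : T * (2 * q) ≤ T * #W) hT
  refine ⟨X, ?_, fun x hx => ⟨?_, hXK x hx⟩, fun x hx x' hx' hxx' => ?_⟩
  · exact Nat.le_of_mul_le_mul_left (by nlinarith : d * q ≤ d * #X) hd
  · obtain ⟨w, hw, hwx, hxw⟩ := hXnear x hx
    obtain ⟨p, rfl⟩ := hWcross w hw
    obtain ⟨h0, h4⟩ := crossing_mem_Icc (by omega) hN p hy
    have hdN : (4 * d : ℝ) ≤ N := by exact_mod_cast (by nlinarith : 4 * d ≤ N)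
    have : (x : ℝ) < N := by linarith [(N.cast_nonneg : (0 : ℝ) ≤ N)]
    exact ⟨by exact_mod_cast h0.trans hwx, by exact_mod_cast this⟩
  · obtain ⟨w, hw, hxw, hwx'⟩ := hXsep x hx x' hx' hxx'
    obtain ⟨p, rfl⟩ := hWcross w hw
    exact ⟨p, hxw, hwx'⟩

theorem card_le_two_mul_card_filter_le {ι : Type*} {s : Finset ι} {f : ι → ℕ} {a : ℕ}
    (h : 2 * ∑ i ∈ s, f i ≤ a * #s) : #s ≤ 2 * #{i ∈ s | f i ≤ a} := by
  have hlarge : (a + 1) * #{i ∈ s | ¬ f i ≤ a} ≤ ∑ i ∈ s, f i := by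
    calc (a + 1) * #{i ∈ s | ¬ f i ≤ a} ≤ ∑ i ∈ s with ¬ f i ≤ a, f i := by
          rw [mul_comm]
          exact card_nsmul_le_sum _ f (a + 1) fun i hi => not_le.1 (mem_filter.1 hi).2
      _ ≤ ∑ i ∈ s, f i := sum_le_sum_of_subset (filter_subset _ s)
  have hhalf : 2 * #{i ∈ s | ¬ f i ≤ a} ≤ #s :=
    Nat.le_of_mul_le_mul_left (by linarith : (a + 1) * (2 * _) ≤ (a + 1) * #s) a.succ_pos
  have hsplit := card_filter_add_card_filter_not (s := s) (f · ≤ a)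
  omega

theorem sum_range_mul_eq_sum_sum (c : ℕ → ℕ) (k u : ℕ) :
    ∑ r ∈ range (k * u), c r = ∑ s ∈ range k, ∑ t ∈ range u, c (s * u + t) := by
  induction k with
  | zero => simp
  | succ k ih => rw [Nat.succ_mul, sum_range_add, ih, sum_range_succ]

theorem le_two_mul_card_strips {c : ℕ → ℕ} {k u b : ℕ}
    (h : 4 * ∑ r ∈ range (k * u), c r ≤ b * (k * u)) :
    k ≤ 2 * #{s ∈ range k | u ≤ 2 * #{t ∈ range u | c (s * u + t) ≤ b}} := by
  rw [sum_range_mul_eq_sum_sum] at h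
  have hstrips : k ≤ 2 * #{s ∈ range k | 2 * ∑ t ∈ range u, c (s * u + t) ≤ b * u} := by
    simpa using card_le_two_mul_card_filter_le (s := range k) (a := b * u)
      (f := fun s => 2 * ∑ t ∈ range u, c (s * u + t)) (by
        rw [← mul_sum, card_range]
        linarith)
  refine hstrips.trans (Nat.mul_le_mul_left 2 (card_le_card
    (monotone_filter_right _ fun s _ hs => ?_)))
  simpa using card_le_two_mul_card_filter_le (s := range u) (f := fun t => c (s * u + t))
    (by simpa using hs)

theorem le_two_mul_card_strips_closePairs {N k u T : ℕ} {δ : ℝ} (hδ : 1 ≤ δ)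
    (hu : 2 * (k + δ) ≤ u) (hN : 8 * (u * k) ≤ N) (hlog : 10 * δ * k * (1 + Real.log k) ≤ u)
    (hT : 4 * (k * u + N) ≤ T * (k * u)) :
    k ≤ 2 * #{s ∈ range k | u ≤ 2 * #{t ∈ range u |
      #(closePairs N u k δ (k + (s * u + t) : ℕ)) ≤ T * k ^ 2}} := by
  refine le_two_mul_card_strips (c := fun r => #(closePairs N u k δ (k + r : ℕ))) ?_
  have hrows : ∀ y ∈ Ico k (k + k * u), 2 * y ≤ N := by
    intro y hy
    rw [mem_Ico] at hy
    have hupos : 1 ≤ u := by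
      exact_mod_cast (by linarith [(k.cast_nonneg : (0 : ℝ) ≤ k)] : (1 : ℝ) ≤ u)
    nlinarith
  have hsum := sum_card_closePairs_le hδ hu hN hlog hrows
  rw [sum_Ico_eq_sum_range, Nat.card_Ico, Nat.add_sub_cancel_left] at hsum
  nlinarith

theorem exists_fresh_row {R : Finset ℕ} {m : ℕ} (hR : m + 2 < #R) (P : ℕ → ℤ × ℤ) (a : ℤ) :
    ∃ t ∈ R, 2 ≤ t ∧ ∀ i < m, (P i).2 ≠ a + t := by
  have hcard : #(range 2 ∪ (range m).image fun i => ((P i).2 - a).toNat) < #R := by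
    calc _ ≤ 2 + m := (card_union_le _ _).trans
          (add_le_add (card_range 2).le (card_image_le.trans (card_range m).le))
      _ < #R := by omega
  obtain ⟨t, htR, ht⟩ := exists_mem_notMem_of_card_lt_card hcard
  rw [mem_union, not_or, mem_range, not_lt] at ht
  refine ⟨t, htR, ht.1, fun i hi hrow => ht.2 (mem_image.2 ⟨i, mem_range.2 hi, ?_⟩)⟩
  omega

section Extensions

variable {N k u d m : ℕ} {P : ℕ → ℤ × ℤ}

theorem IsFrame.chirotope_update_ne_of_crossing (h : IsFrame N k u P) (hm : 4 * k ≤ m)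
    (hN : 8 * k ≤ N) {x x' y : ℤ} {p : Fin k × Fin k} (hx : x < crossing N u p y)
    (hx' : crossing N u p y ≤ x') :
    chirotope (m + 1) (Function.update P m (x, y)) ≠
      chirotope (m + 1) (Function.update P m (x', y)) := by
  have hiff : ∀ x : ℤ, 0 < orient (P p.1) (P (k + p.2)) (x, y) ↔ x < crossing N u p y := by
    intro x
    rw [h.lower p.1 p.1.is_lt, h.upper p.2 p.2.is_lt]
    exact orient_pos_iff_lt_rowCrossing (lowerArc_snd_lt_upperArc_snd hN p.1 p.2) x y
  exact chirotope_update_ne (by omega) (by omega) ((hiff x).2 hx)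
    ((hiff x').not.2 (not_lt.2 hx'))

theorem IsFrame.chirotope_update_ne_of_strip_lt (h : IsFrame N k u P) (hm : 4 * k ≤ m)
    {s s' : ℕ} (hss' : s < s') (hs' : s' < k) {x x' y y' : ℤ} (hx : 0 ≤ x)
    (hy : y < k + (s + 1) * u) (hx' : x' < N) (hy' : k + s' * u + 2 ≤ y') :
    chirotope (m + 1) (Function.update P m (x, y)) ≠
      chirotope (m + 1) (Function.update P m (x', y')) := by
  have hbelow : y < k + s' * u := by
    refine hy.trans_le ?_
    gcongr
    exact_mod_cast hss'
  exact (chirotope_update_ne (Nat.lt_succ_self _) (by omega) (h.orient_pos hs' hx' hy')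
    (h.orient_neg hs' hx hbelow).le.not_gt).symm

theorem IsFrame.exists_strip_columns {T q s : ℕ} (h : IsFrame N k u P) (hP : IsGridConfig N m P)
    (hm : 4 * k ≤ m) (hd : 0 < d) (hu : 2 * (k + 2 * d) ≤ u) (hN : 8 * (u * k) ≤ N)
    (hq : 2 * T * q ≤ k ^ 2) (hmq : m ^ 2 ≤ d * q) (hmu : 2 * (m + 2) < u) (hs : s < k)
    (hgood : u ≤ 2 * #{t ∈ range u | #(closePairs N u k (2 * d) (k + (s * u + t) : ℕ)) ≤
      T * k ^ 2}) :
    ∃ y : ℤ, k + s * u + 2 ≤ y ∧ y < k + (s + 1) * u ∧ ∃ X : Finset ℤ, q ≤ #X ∧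
      (∀ x ∈ X, IsGridConfig N (m + 1) (Function.update P m (x, y))) ∧
      (∀ x ∈ X, x ∈ Set.Ico (0 : ℤ) N) ∧
      Set.InjOn (fun x => chirotope (m + 1) (Function.update P m (x, y))) X := by
  obtain ⟨t, ht, ht2, hfresh⟩ := exists_fresh_row (m := m)
    (lt_of_mul_lt_mul_left (hmu.trans_le hgood) two_pos.le) P ((k + s * u : ℕ) : ℤ)
  obtain ⟨htu, hclose⟩ := mem_filter.1 ht
  rw [mem_range] at htu
  have hyu : s * u + t < k * u := by nlinarith
  set y : ℕ := k + (s * u + t) with hy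
  have hyN : y + k ≤ N := by nlinarith
  have hrow : ((k + s * u : ℕ) : ℤ) + t = y := by push_cast [hy]; ring
  simp only [hrow] at hfresh
  obtain ⟨K, hK, hext⟩ := hP.exists_forbidden_columns ⟨by omega, by omega⟩ hfresh
  obtain ⟨X, hqX, hX, hXsep⟩ := exists_distinguished_columns (by omega) hd hu hN
    ⟨by exact_mod_cast (by omega : k ≤ y), le_sub_iff_add_le.2 (by exact_mod_cast hyN)⟩ hclose hq
    (hK.trans hmq)
  have hne : ∀ x ∈ X, ∀ x' ∈ X, x < x' → chirotope (m + 1) (Function.update P m (x, (y : ℤ))) ≠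
      chirotope (m + 1) (Function.update P m (x', (y : ℤ))) := by
    intro x hx x' hx' hxx'
    obtain ⟨p, hp, hp'⟩ := hXsep x hx x' hx' hxx'
    exact h.chirotope_update_ne_of_crossing hm (by nlinarith) (p := p) (by exact_mod_cast hp)
      (by exact_mod_cast hp')
  refine ⟨y, by omega, by rw [← hrow]; push_cast; nlinarith, X, hqX,
    fun x hx => hext x (hX x hx).1 (hX x hx).2, fun x hx => (hX x hx).1, fun x hx x' hx' hxx' => ?_⟩
  rcases lt_trichotomy x x' with hlt | heq | hgt
  exacts [absurd hxx' (hne x hx x' hx' hlt), heq, absurd hxx'.symm (hne x' hx' x hx hgt)]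

theorem IsFrame.exists_extensions {T q : ℕ} (h : IsFrame N k u P) (hP : IsGridConfig N m P)
    (hm : 4 * k ≤ m) (hd : 0 < d) (hu : 2 * (k + 2 * d) ≤ u) (hN : 8 * (u * k) ≤ N)
    (hlog : 20 * d * k * (1 + Real.log k) ≤ u) (hT : 4 * (k * u + N) ≤ T * (k * u))
    (hq : 2 * T * q ≤ k ^ 2) (hmq : m ^ 2 ≤ d * q) (hmu : 2 * (m + 2) < u) :
    ∃ C : Finset (ℤ × ℤ), k / 2 * q ≤ #C ∧
      (∀ p ∈ C, IsGridConfig N (m + 1) (Function.update P m p)) ∧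
      Set.InjOn (fun p => chirotope (m + 1) (Function.update P m p)) C := by
  set good : Finset ℕ := {s ∈ range k | u ≤ 2 * #{t ∈ range u |
    #(closePairs N u k (2 * d) (k + (s * u + t) : ℕ)) ≤ T * k ^ 2}}
  have hcard : k ≤ 2 * #good := le_two_mul_card_strips_closePairs
    (by exact_mod_cast (by omega : 1 ≤ 2 * d)) (by exact_mod_cast hu) hN
    (by linarith) hT
  have hstrip := fun s (hs : s ∈ good) => h.exists_strip_columns hP hm hd hu hN hq hmq hmu
    (mem_range.1 (mem_filter.1 hs).1) (mem_filter.1 hs).2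
  choose! row hrow hrow' X hX hconfig hXN hinj using hstrip
  let point : (_ : ℕ) × ℤ → ℤ × ℤ := fun c => (c.2, row c.1)
  have hpoint : Set.InjOn ((fun p => chirotope (m + 1) (Function.update P m p)) ∘ point)
      (good.sigma X) := by
    have hstrips : ∀ s ∈ good, ∀ s' ∈ good, s < s' → ∀ x ∈ X s, ∀ x' ∈ X s',
        chirotope (m + 1) (Function.update P m (x, row s)) ≠
          chirotope (m + 1) (Function.update P m (x', row s')) :=
      fun s hs s' hs' hss' x hx x' hx' => h.chirotope_update_ne_of_strip_lt hm hss'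
        (mem_range.1 (mem_filter.1 hs').1) (hXN s hs x hx).1 (hrow' s hs) (hXN s' hs' x' hx').2
        (hrow s' hs')
    rintro ⟨s, x⟩ hc ⟨s', x'⟩ hc' heq
    obtain ⟨hs, hx⟩ := mem_sigma.1 (mem_coe.1 hc)
    obtain ⟨hs', hx'⟩ := mem_sigma.1 (mem_coe.1 hc')
    rcases lt_trichotomy s s' with hlt | rfl | hgt
    · exact absurd heq (hstrips s hs s' hs' hlt x hx x' hx')
    · obtain rfl : x = x' := hinj s hs hx hx' heq
      rfl
    · exact absurd heq.symm (hstrips s' hs' s hs hgt x' hx' x hx)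
  refine ⟨(good.sigma X).image point, ?_, ?_, ?_⟩
  · calc k / 2 * q ≤ #good * q := by gcongr; omega
      _ ≤ ∑ s ∈ good, #(X s) := card_nsmul_le_sum good _ q hX
      _ = #((good.sigma X).image point) := by
          rw [← card_sigma, card_image_of_injOn hpoint.of_comp]
  · rw [forall_mem_image]
    exact fun c hc => hconfig c.1 (mem_sigma.1 hc).1 c.2 (mem_sigma.1 hc).2
  · rw [coe_image]
    exact hpoint.image_of_comp

end Extensions

/-- Here `u` is the height of a strip, `d` the distance between separated crossings, `T * k ^ 2` the
number of close pairs of lines allowed in a row, and `q` the number of columns used in a row. -/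
theorem pow_le_gridOrderTypes {n N k u d T q : ℕ} {α : ℝ} (hα : (N : ℝ) ≤ (n : ℝ) ^ α)
    (hkn : 4 * k ≤ n) (hd : 0 < d) (hu : 2 * (k + 2 * d) ≤ u) (hN : 8 * (u * k) ≤ N)
    (hlog : 20 * d * k * (1 + Real.log k) ≤ u) (hT : 4 * (k * u + N) ≤ T * (k * u))
    (hq : 2 * T * q ≤ k ^ 2) (hnq : n ^ 2 ≤ d * q) (hnu : 2 * (n + 2) < u)
    (hcols : (4 * k) ^ 2 < N / 4) : (k / 2 * q) ^ (n - 4 * k) ≤ gridOrderTypes n α := by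
  obtain ⟨P₀, hP₀, hframe⟩ := exists_isGridConfig_isFrame (by omega) (by omega) hN hcols
  obtain ⟨F, hcard, hF, hinj⟩ := exists_finset_injOn_chirotope
    (V := fun m P => IsGridConfig N m P ∧ IsFrame N k u P) (Q := k / 2 * q) ⟨hP₀, hframe⟩
    (n - 4 * k) fun m P hm hmn hP => by
      have hmn' : m ≤ n := by omega
      obtain ⟨C, hC, hconfig, hCinj⟩ := hP.2.exists_extensions hP.1 hm hd hu hN hlog hT hq
        ((Nat.pow_le_pow_left hmn' 2).trans hnq) (by omega)
      exact ⟨C, hC, fun p hp => ⟨hconfig p hp, hP.2.update hm p⟩, hCinj⟩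
  rw [Nat.add_sub_cancel' hkn] at hF hinj
  exact hcard.trans (card_le_gridOrderTypes (fun P hP => (hF P hP).1) hinj hα)

theorem le_two_mul_mul_div {a b : ℕ} (hb : 0 < b) (hba : b ≤ a) : a ≤ 2 * b * (a / b) := by
  have hlt : a < b * (a / b + 1) := Nat.lt_mul_div_succ a hb
  have hdiv : 1 ≤ a / b := (Nat.one_le_div_iff hb).2 hba
  nlinarith

theorem sq_le_two_pow {m : ℕ} (hm : 4 ≤ m) : m ^ 2 ≤ 2 ^ m := by
  induction m, hm using Nat.le_induction with
  | base => norm_num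
  | succ m hm ih => rw [pow_succ 2 m]; nlinarith

theorem natLog_two_le_two_mul_log (n : ℕ) : (Nat.log 2 n : ℝ) ≤ 2 * Real.log n := by
  have hlogb := Real.natLog_le_logb n 2
  rw [← Real.log_div_log, Nat.cast_ofNat, le_div_iff₀ (Real.log_pos one_lt_two)] at hlogb
  nlinarith [Real.log_two_gt_d9, (Nat.cast_nonneg _ : (0 : ℝ) ≤ Nat.log 2 n)]

theorem log_le_natLog_two_add_one {n : ℕ} (hn : n ≠ 0) : Real.log n ≤ Nat.log 2 n + 1 := by
  have hlt : (n : ℝ) ≤ 2 ^ (Nat.log 2 n + 1) := by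
    exact_mod_cast (Nat.lt_pow_succ_log_self one_lt_two n).le
  have hlog := Real.log_le_log (by positivity) hlt
  rw [Real.log_pow, Nat.cast_add_one] at hlog
  nlinarith [Real.log_two_lt_d9, (Nat.cast_nonneg _ : (0 : ℝ) ≤ Nat.log 2 n)]

theorem exists_strip_count_and_column_count {n L : ℕ} (hL : 24 ≤ L) (hLn : L ^ 2 ≤ n) :
    ∃ k q : ℕ, L ≤ k ∧ k * L ≤ n ∧ n ≤ 2 * L * k ∧ 24 * L * q ≤ k ^ 2 ∧
      n ^ 2 ≤ 192 * L ^ 3 * q ∧ n ^ 3 ≤ 1536 * L ^ 4 * (k / 2 * q) := by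
  set k := n / L
  have hLk : L ≤ k := (Nat.le_div_iff_mul_le (by omega)).2 (by rwa [← sq])
  have hk : n ≤ 2 * L * k := le_two_mul_mul_div (by omega) (by nlinarith)
  have hhalf : k ≤ 2 * 2 * (k / 2) := le_two_mul_mul_div two_pos (by omega)
  set q := k ^ 2 / (24 * L)
  have hq : k ^ 2 ≤ 2 * (24 * L) * q := le_two_mul_mul_div (by omega) (by nlinarith)
  have hnq : n ^ 2 ≤ 192 * L ^ 3 * q := by
    calc n ^ 2 ≤ (2 * L * k) ^ 2 := by gcongr
      _ = 4 * L ^ 2 * k ^ 2 := by ring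
      _ ≤ 4 * L ^ 2 * (2 * (24 * L) * q) := by gcongr
      _ = 192 * L ^ 3 * q := by ring
  refine ⟨k, q, hLk, Nat.div_mul_le_self n L, hk, Nat.mul_div_le _ _, hnq, ?_⟩
  calc n ^ 3 = n * n ^ 2 := by ring
    _ ≤ 2 * L * (2 * 2 * (k / 2)) * (192 * L ^ 3 * q) := by gcongr; exact hk.trans (by gcongr)
    _ = 1536 * L ^ 4 * (k / 2 * q) := by ring

theorem pow_le_gridOrderTypes_of_mul_le {n L k q : ℕ} {α : ℝ} (hL : 24 ≤ L) (hLk : L ≤ k)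
    (hkL : k * L ≤ n) (hk : n ≤ 2 * L * k) (hq : 24 * L * q ≤ k ^ 2)
    (hnq : n ^ 2 ≤ 192 * L ^ 3 * q) (hlog : Real.log n ≤ L + 1)
    (hα : 7680 * (n : ℝ) ^ 2 * L ^ 3 ≤ (n : ℝ) ^ α) :
    (k / 2 * q) ^ (n - 4 * k) ≤ gridOrderTypes n α := by
  have h24k : 24 * k ≤ n := by nlinarith
  have hL3 : L ≤ L ^ 3 := Nat.le_self_pow three_ne_zero L
  have hlogk : 20 * (192 * L ^ 3 : ℕ) * (k : ℝ) * (1 + Real.log k) ≤ (7680 * L ^ 3 * n : ℕ) := by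
    have hlogk : 1 + Real.log k ≤ 2 * L := by
      have hkn : Real.log k ≤ Real.log n :=
        Real.log_le_log (by exact_mod_cast (by omega : 0 < k)) (by exact_mod_cast (by omega))
      have hL' : (24 : ℝ) ≤ L := by exact_mod_cast hL
      linarith
    calc _ ≤ 20 * (192 * L ^ 3 : ℕ) * (k : ℝ) * (2 * L) := by gcongr
      _ = 7680 * L ^ 3 * (k * L : ℕ) := by push_cast; ring
      _ ≤ 7680 * L ^ 3 * n := by gcongr
      _ = _ := by push_cast; ring
  set u := 7680 * L ^ 3 * n with hu
  have hnu : 7680 * 24 * n ≤ u := by rw [hu]; gcongr; omega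
  have hLu : 7680 * L ^ 3 ≤ u := Nat.le_mul_of_pos_right _ (by omega)
  refine pow_le_gridOrderTypes (N := n * u) (d := 192 * L ^ 3) (T := 12 * L) ?_ (by omega)
    (by omega) (by omega) ?_ hlogk ?_ (by linarith) hnq (by omega) ?_
  · exact le_of_eq_of_le (by push_cast [hu]; ring) hα
  · calc 8 * (u * k) = 8 * k * u := by ring
      _ ≤ n * u := by gcongr; omega
  · calc 4 * (k * u + n * u) = 4 * (k + n) * u := by ring
      _ ≤ 12 * L * k * u := by gcongr ?_ * u; nlinarith
      _ = 12 * L * (k * u) := by ring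
  · have hNu : 4 * n ^ 2 ≤ n * u := by nlinarith
    have hcols : (4 * k) ^ 2 < n ^ 2 := Nat.pow_lt_pow_left (by omega) two_ne_zero
    omega

theorem three_mul_log_sub_le_log {n L Q : ℕ} (hn : n ≠ 0) (hL : L ≠ 0)
    (hLlog : (L : ℝ) ≤ 2 * Real.log n) (hQ : n ^ 3 ≤ 1536 * L ^ 4 * Q) :
    3 * Real.log n - (12 + 4 * Real.log (Real.log n)) ≤ Real.log Q := by
  have hQ0 : Q ≠ 0 := by
    rintro rfl
    exact hn (by simpa using hQ)
  have hL0 : (0 : ℝ) < L := by exact_mod_cast Nat.pos_of_ne_zero hL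
  have hlogL : Real.log L ≤ 1 + Real.log (Real.log n) := by
    have h := Real.log_le_log hL0 hLlog
    rw [Real.log_mul two_ne_zero (by linarith)] at h
    linarith [Real.log_two_lt_d9]
  have hlog1536 : Real.log 1536 ≤ 8 := by
    rw [Real.log_le_iff_le_exp (by norm_num)]
    calc (1536 : ℝ) ≤ 2.7 ^ 8 := by norm_num
      _ ≤ Real.exp 1 ^ 8 := by gcongr; linarith [Real.exp_one_gt_d9]
      _ = Real.exp 8 := by rw [← Real.exp_nat_mul]; norm_num
  have hlogQ := Real.log_le_log (by positivity)
    (by exact_mod_cast hQ : (n : ℝ) ^ 3 ≤ 1536 * L ^ 4 * Q)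
  rw [Real.log_pow, Real.log_mul (by positivity) (by positivity),
    Real.log_mul (by norm_num) (by positivity), Real.log_pow] at hlogQ
  push_cast at hlogQ
  linarith

theorem exp_le_pow_of_cube_le {n L k Q : ℕ} (hL : 24 ≤ L) (hLlog : (L : ℝ) ≤ 2 * Real.log n)
    (hlog : Real.log n ≤ L + 1) (hkL : k * L ≤ n) (hQ : n ^ 3 ≤ 1536 * L ^ 4 * Q) :
    Real.exp (3 * (n : ℝ) * Real.log n - 40 * ((n : ℝ) * Real.log (Real.log n))) ≤
      (Q : ℝ) ^ (n - 4 * k) := by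
  have hLr : (24 : ℝ) ≤ L := by exact_mod_cast hL
  have hn : n ≠ 0 := by
    rintro rfl
    norm_num at hLlog
    linarith
  have hQ0 : Q ≠ 0 := by
    rintro rfl
    exact hn (by simpa using hQ)
  have hloglog : 1 ≤ Real.log (Real.log n) := by
    rw [Real.le_log_iff_exp_le (by linarith)]
    linarith [Real.exp_one_lt_d9]
  have hklog : (k : ℝ) * Real.log n ≤ 2 * n := by
    calc (k : ℝ) * Real.log n ≤ k * (2 * L) := by gcongr; linarith
      _ = 2 * (k * L : ℕ) := by push_cast; ring
      _ ≤ 2 * n := by gcongr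
  have hkn : 4 * k ≤ n := by nlinarith
  have hnk : (0 : ℝ) ≤ n - (4 * k : ℕ) := sub_nonneg.2 (by exact_mod_cast hkn)
  rw [← Real.exp_log (by positivity : (0 : ℝ) < (Q : ℝ) ^ (n - 4 * k)), Real.exp_le_exp,
    Real.log_pow, Nat.cast_sub hkn]
  refine le_trans ?_ (mul_le_mul_of_nonneg_left
    (three_mul_log_sub_le_log hn (by omega) hLlog hQ) hnk)
  push_cast
  nlinarith [mul_le_mul_of_nonneg_left hloglog n.cast_nonneg]

theorem eventually_mul_natLog_pow_le_rpow {β : ℝ} (hβ : 2 < β) :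
    ∀ᶠ n : ℕ in Filter.atTop, 7680 * (n : ℝ) ^ 2 * Nat.log 2 n ^ 3 ≤ (n : ℝ) ^ β := by
  have hlittle := (isLittleO_log_rpow_rpow_atTop 3 (sub_pos.2 hβ)).comp_tendsto
    tendsto_natCast_atTop_atTop
  filter_upwards [hlittle.bound (by norm_num : (0 : ℝ) < 1 / 61440),
    Filter.eventually_ge_atTop 1] with n hbound hn
  have hn' : (0 : ℝ) < n := by exact_mod_cast hn
  have hlog : 0 ≤ Real.log n := Real.log_natCast_nonneg n
  have hpow : 61440 * Real.log n ^ 3 ≤ (n : ℝ) ^ (β - 2) := by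
    simp only [comp_apply, Real.norm_eq_abs] at hbound
    rw [abs_of_nonneg (by positivity), abs_of_nonneg (by positivity)] at hbound
    norm_cast at hbound
    linarith
  calc 7680 * (n : ℝ) ^ 2 * Nat.log 2 n ^ 3 ≤ 7680 * (n : ℝ) ^ 2 * (2 * Real.log n) ^ 3 := by
        gcongr; exact natLog_two_le_two_mul_log n
    _ = (n : ℝ) ^ 2 * (61440 * Real.log n ^ 3) := by ring
    _ ≤ (n : ℝ) ^ 2 * (n : ℝ) ^ (β - 2) := by gcongr
    _ = (n : ℝ) ^ β := by
        rw [← Real.rpow_natCast, ← Real.rpow_add hn', Nat.cast_ofNat, add_sub_cancel]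

theorem theorem2_general :
    ∃ C : ℝ, 0 < C ∧ ∀ β : ℝ, 2 < β → ∃ n₀ : ℕ, ∀ α : ℝ, β ≤ α → ∀ n : ℕ, n₀ ≤ n →
      Real.exp (3 * (n : ℝ) * Real.log (n : ℝ) - C * ((n : ℝ) * Real.log (Real.log (n : ℝ)))) ≤
        (gridOrderTypes n α : ℝ) := by
  refine ⟨40, by norm_num, fun β hβ => ?_⟩
  obtain ⟨n₁, hn₁⟩ := Filter.eventually_atTop.1 (eventually_mul_natLog_pow_le_rpow hβ)
  refine ⟨max n₁ (2 ^ 24), fun α hα n hn => ?_⟩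
  obtain ⟨hnn₁, hn24⟩ := max_le_iff.1 hn
  have hn0 : n ≠ 0 := (lt_of_lt_of_le (by norm_num) hn24).ne'
  have hL : 24 ≤ Nat.log 2 n := Nat.le_log_of_pow_le one_lt_two hn24
  have hLn : Nat.log 2 n ^ 2 ≤ n := (sq_le_two_pow (by omega)).trans (Nat.pow_log_le_self 2 hn0)
  have hlog : Real.log n ≤ Nat.log 2 n + 1 := log_le_natLog_two_add_one hn0
  have hside : 7680 * (n : ℝ) ^ 2 * Nat.log 2 n ^ 3 ≤ (n : ℝ) ^ α := (hn₁ n hnn₁).trans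
    (Real.rpow_le_rpow_of_exponent_le (by exact_mod_cast Nat.one_le_iff_ne_zero.2 hn0) hα)
  obtain ⟨k, q, hLk, hkL, hk, hq, hnq, hcube⟩ := exists_strip_count_and_column_count hL hLn
  refine (exp_le_pow_of_cube_le hL (natLog_two_le_two_mul_log n) hlog hkL hcube).trans ?_
  exact_mod_cast pow_le_gridOrderTypes_of_mul_le hL hLk hkL hk hq hnq hlog hside

theorem theorem2 :
    ∃ C : ℝ, 0 < C ∧ ∃ n₀ : ℕ, ∀ α : ℝ, 5 / 2 ≤ α → ∀ n : ℕ, n₀ ≤ n →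
      Real.exp (3 * (n : ℝ) * Real.log (n : ℝ) - C * ((n : ℝ) * Real.log (Real.log (n : ℝ)))) ≤
        (gridOrderTypes n α : ℝ) := by
  obtain ⟨C, hC, h⟩ := theorem2_general
  exact ⟨C, hC, h (5 / 2) (by norm_num)⟩
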